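/- Let $\mathbb H=\{\tau\in\mathbb C : \mathrm{Im}(\tau)>0\}$. For $p,q\in\{0,1\}$ and $\tau\in\mathbb H$ put $$\vartheta_{pq}(\tau)=\sum_{n\in\mathbb Z}\exp\Big(\pi i\big(n+\tfrac p2\big)^2\tau+2\pi i\big(n+\tfrac p2\big)\tfrac q2\Big),\qquad \lambda(\tau)=\frac{\vartheta_{10}(\tau)^4}{\vartheta_{00}(\tau)^4}.$$ Let $F(z)=F(\tfrac12,\tfrac12,1;z)$ be the single-valued function on $\mathbb C\setminus\{1\}$ that is the holomorphic continuation to $\mathbb C\setminus[1,\infty)$ of the hypergeometric series $\sum_{n\ge0}\frac{(1/2)_n(1/2)_n}{(1)_n\,n!}z^n$ ($|z|<1$) and whose value at a real $t>1$ is its limit as $z\to t$ with $\mathrm{Im}(z)>0$. Let $$\mathbb D(2)=\{\tau\in\mathbb H : -1<\mathrm{Re}(\tau)\le 1,\ |\tau-\tfrac12|\ge\tfrac12,\ |\tau+\tfrac12|>\tfrac12\},$$ $$\Gamma(2,4)=\{g=(g_{ij})\in \mathrm{SL}_2(\mathbb Z) : g_{11}\equiv g_{22}\equiv 1 \bmod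 4,\ g_{12}\equiv g_{21}\equiv 0\bmod 2\}.$$ Then $F$ exists, $\vartheta_{00}$ has no zero in $\mathbb H$, $\lambda$ maps $\mathbb H$ to $\mathbb C\setminus\{0,1\}$, and every $\tau\in\mathbb H$ can be written as $\tau=g\cdot\tau_0=\frac{g_{11}\tau_0+g_{12}}{g_{21}\tau_0+g_{22}}$ with $\tau_0\in\mathbb D(2)$ and $g\in\Gamma(2,4)$. For all such $\tau,\tau_0,g$ and every path $\gamma$ in $\mathbb H$ from $\tau_0$ to $\tau$, with image $\rho=\lambda\circ\gamma$ in $\mathbb C\setminus\{0,1\}$, the function $F$ can be continued analytically along $\rho$, the value $F_\rho(\tfrac12,\tfrac12,1;\lambda(\tau))$ of the continuation at the end point of $\rho$ is well defined, and $$\vartheta_{00}(\tau)^2=F_\rho\big(\tfrac12,\tfrac12,1;\lambda(\tau)\big)=(g_{21}\tau_0+g_{22})\,F\big(\tfrac12,\tfrac12,1;\lambda(\tau_0)\big)=\frac{F\big(\tfrac12,\tfrac12,1;\lambda(\tau)\big)}{-g_{21}\tau+g_{11}}.$$ (The initial germ of the continuation is that of $F$ at $\lambda(\tau_0)$; if $\lambda(\tau_0)\in(1,\infty)$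 it is the germ of the analytic function that agrees with $F$ on the side $\mathrm{Im}(z)\ge0$.) -/

import Mathlib

open Filter Topology Set
open scoped UpperHalfPlane MatrixGroups

namespace JacobiExt

/-- The theta constant `ϑ_{pq}(τ) = ∑_{n ∈ ℤ} exp(πi (n + p/2)² τ + 2πi (n + p/2) q/2)`
with characteristics `p, q`. -/
noncomputable def theta (p q : ℕ) (τ : ℍ) : ℂ :=
  ∑' n : ℤ, Complex.exp (Real.pi * Complex.I * ((n : ℂ) + (p : ℂ) / 2) ^ 2 * (τ : ℂ)
    + 2 * Real.pi * Complex.I * ((n : ℂ) + (p : ℂ) / 2) * ((q : ℂ) / 2))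

/-- The lambda function `λ(τ) = ϑ₁₀(τ)⁴ / ϑ₀₀(τ)⁴`. -/
noncomputable def lam (τ : ℍ) : ℂ := theta 1 0 τ ^ 4 / theta 0 0 τ ^ 4

/-- The region `𝔻(2)`, a fundamental region of `Γ(2)` in the upper half plane. -/
def D2 : Set ℍ :=
  {τ | -1 < τ.re ∧ τ.re ≤ 1 ∧ 1 / 2 ≤ ‖(τ : ℂ) - 1 / 2‖ ∧ 1 / 2 < ‖(τ : ℂ) + 1 / 2‖}

/-- The group `Γ(2,4)` of all `g ∈ SL₂(ℤ)` with `g₁₁, g₂₂ ≡ 1 mod 4` and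
`g₁₂, g₂₁ ≡ 0 mod 2`. -/
def Gamma24 : Subgroup SL(2, ℤ) where
  carrier := {g | g 0 0 ≡ 1 [ZMOD 4] ∧ g 1 1 ≡ 1 [ZMOD 4] ∧
    g 0 1 ≡ 0 [ZMOD 2] ∧ g 1 0 ≡ 0 [ZMOD 2]}
  one_mem' := by simp [Int.ModEq]
  mul_mem' := by
    rintro g h ⟨a1, a2, a3, a4⟩ ⟨b1, b2, b3, b4⟩
    obtain ⟨x1, hx1⟩ := a1.symm.dvd
    obtain ⟨x2, hx2⟩ := a2.symm.dvd
    obtain ⟨x3, hx3⟩ := a3.symm.dvd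
    obtain ⟨x4, hx4⟩ := a4.symm.dvd
    obtain ⟨y1, hy1⟩ := b1.symm.dvd
    obtain ⟨y2, hy2⟩ := b2.symm.dvd
    obtain ⟨y3, hy3⟩ := b3.symm.dvd
    obtain ⟨y4, hy4⟩ := b4.symm.dvd
    have e1 : g 0 0 = 1 + 4 * x1 := by linarith
    have e2 : g 1 1 = 1 + 4 * x2 := by linarith
    have e3 : g 0 1 = 2 * x3 := by linarith
    have e4 : g 1 0 = 2 * x4 := by linarith
    have f1 : h 0 0 = 1 + 4 * y1 := by linarith
    have f2 : h 1 1 = 1 + 4 * y2 := by linarith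
    have f3 : h 0 1 = 2 * y3 := by linarith
    have f4 : h 1 0 = 2 * y4 := by linarith
    simp only [mem_ofPred_eq, Matrix.SpecialLinearGroup.coe_mul, Matrix.mul_apply,
      Fin.sum_univ_two, e1, e2, e3, e4, f1, f2, f3, f4]
    refine ⟨?_, ?_, ?_, ?_⟩ <;> refine (Int.modEq_of_dvd ?_).symm
    · exact ⟨x1 + y1 + 4 * x1 * y1 + x3 * y4, by ring⟩
    · exact ⟨x2 + y2 + 4 * x2 * y2 + x4 * y3, by ring⟩
    · exact ⟨(1 + 4 * x1) * y3 + x3 * (1 + 4 * y2), by ring⟩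
    · exact ⟨x4 * (1 + 4 * y1) + (1 + 4 * x2) * y4, by ring⟩
  inv_mem' := by
    rintro g ⟨a1, a2, a3, a4⟩
    rw [mem_ofPred_eq, Matrix.SpecialLinearGroup.SL2_inv_expl]
    refine ⟨by simpa using a2, by simpa using a1, ?_, ?_⟩
    · simpa using a3.neg
    · simpa using a4.neg

/-- The half line `[1, ∞)` in the complex plane. -/
def cut : Set ℂ := {z | z.im = 0 ∧ 1 ≤ z.re}

/-- `F` is the single-valued extension to `ℂ ∖ {1}` of the hypergeometric series: it is
holomorphic on `ℂ ∖ [1, ∞)`, it is the sum of the series on the unit disk, and its value at a real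
`t > 1` is its limit at `t` through the upper half plane.
These conditions determine `F` on `ℂ ∖ {1}`. -/
structure IsSingleValuedHGF (a b c : ℂ) (F : ℂ → ℂ) : Prop where
  differentiableOn : DifferentiableOn ℂ F cutᶜ
  eq_series : ∀ z : ℂ, ‖z‖ < 1 → F z = ordinaryHypergeometric a b c z
  tendsto_cut : ∀ t : ℝ, 1 < t → Tendsto F (𝓝[{w : ℂ | 0 < w.im}] (t : ℂ)) (𝓝 (F t))

/-- The hypergeometric function `F(a,b,c;z)` as a single-valued function on `ℂ ∖ {1}`
(its value at `1` is irrelevant). -/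
noncomputable def hgf (a b c : ℂ) : ℂ → ℂ := Classical.epsilon (IsSingleValuedHGF a b c)

/-- `f` is an analytic continuation along the path `ρ` in `ℂ ∖ {0, 1}` of the hypergeometric
function: `f t` represents a germ of analytic function at `ρ t`, germs at nearby parameters are
compatible, and the germ at the starting point `ρ 0` is the one of `F(a,b,c;z)`.
If `ρ 0` lies in `(1, ∞)`, where `F(a,b,c;z)` is continuous only from above,
the germ is that of the analytic function which agrees with `F(a,b,c;z)` on the side `Im z ≥ 0`. -/
structure IsContinuationAlong (a b c : ℂ) (ρ : unitInterval → ℂ)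
    (f : unitInterval → ℂ → ℂ) : Prop where
  continuous : Continuous ρ
  avoids : ∀ t, ρ t ≠ 0 ∧ ρ t ≠ 1
  analyticAt : ∀ t, AnalyticAt ℂ (f t) (ρ t)
  compatible : ∀ t, ∀ᶠ s in 𝓝 t, f s =ᶠ[𝓝 (ρ s)] f t
  initial : ∀ᶠ w in 𝓝 (ρ 0), (ρ 0 ∈ cut → 0 ≤ w.im) → f 0 w = hgf a b c w

/-- `v` is the value at the end point of `ρ` of an analytic continuation of `F(a,b,c;z)`
along `ρ`. -/
def IsContinuationValue (a b c : ℂ) (ρ : unitInterval → ℂ) (v : ℂ) : Prop :=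
  ∃ f, IsContinuationAlong a b c ρ f ∧ f 1 (ρ 1) = v

/-- `F_ρ(a,b,c;w)`: the value at the end point `w` of `ρ` of the analytic continuation of
`F(a,b,c;z)` along `ρ`. -/
noncomputable def hgfAlong (a b c : ℂ) (ρ : unitInterval → ℂ) : ℂ :=
  Classical.epsilon (IsContinuationValue a b c ρ)

end JacobiExt

namespace JacobiExt

/-! The core is Jacobi's formula ϑ₀₀² = F(λ) on the fundamental region; modularity and analytic
continuation carry it to the whole half plane.

On the imaginary axis the formula is a limit argument. Euler's integral `eulerInt` represents F, and
Parseval gives Landen's transformation F(4x/(1+x)²) = (1+x)F(x²) (`eulerInt_landen`). With x =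
ϑ₁₀(2τ)²/ϑ₀₀(2τ)², the duplication formulas `th00_sq` and `th10_sq` show that F(λ)/ϑ₀₀² takes the
same value at τ and 2τ. Along 2ⁿτ this quotient tends to 1, so it equals 1.

The identity theorem extends this to the interior of 𝔻(2), once λ is known to avoid [1, ∞) there.
That is `lamC_im_pos`: Im λ > 0 on the right half, by the maximum principle for exp(iλ), and the
left half follows by reflection. On the line Re τ = 1 the formula persists by continuity, since λ <
0 there. On the circle |τ - 1/2| = 1/2 one has λ > 1, and the outer side of the circle maps to Im >
0, so the boundary value of F from above is the right one (`tendsto_of_circle`). The same limit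
shows that the single-valued F exists.

Γ(2,4) is reached by a Euclidean descent through triangular matrices, each of which fixes λ and
multiplies ϑ₀₀² by the automorphy factor (`Gamma24_le_thetaGroup`). This gives the last two
expressions for ϑ₀₀(τ)².

For the continuation, λ′ has no zero (`deriv_lamC_ne_zero`), so ϑ₀₀² composed with local inverses of
λ supplies compatible germs along any path; the identity theorem makes the continuation unique. -/

/-! ### Theta constants: series, translation and inversion -/

/-- The theta constant `ϑ₀₀` as a function on `ℂ`. -/
noncomputable def th00 (τ : ℂ) : ℂ := jacobiTheta₂ 0 τ

/-- The theta constant `ϑ₀₁` as a function on `ℂ`. -/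
noncomputable def th01 (τ : ℂ) : ℂ := jacobiTheta₂ (1 / 2) τ

/-- The theta constant `ϑ₁₀` as a function on `ℂ`. -/
noncomputable def th10 (τ : ℂ) : ℂ :=
  Complex.exp (Real.pi * Complex.I * τ / 4) * jacobiTheta₂ (τ / 2) τ

lemma hasSum_th00 {τ : ℂ} (hτ : 0 < τ.im) :
    HasSum (fun n : ℤ => Complex.exp (Real.pi * Complex.I * (n : ℂ) ^ 2 * τ)) (th00 τ) := by
  rw [th00]
  convert hasSum_jacobiTheta₂_term 0 hτ using 2 with n
  simp [jacobiTheta₂_term]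

lemma hasSum_th01 {τ : ℂ} (hτ : 0 < τ.im) :
    HasSum (fun n : ℤ => Complex.exp (Real.pi * Complex.I * n
      + Real.pi * Complex.I * (n : ℂ) ^ 2 * τ)) (th01 τ) := by
  rw [th01]
  convert hasSum_jacobiTheta₂_term (1 / 2) hτ using 2 with n
  rw [jacobiTheta₂_term]
  congr 1
  ring

lemma hasSum_th10 {τ : ℂ} (hτ : 0 < τ.im) :
    HasSum (fun n : ℤ => Complex.exp (Real.pi * Complex.I * ((n : ℂ) + 1 / 2) ^ 2 * τ))
      (th10 τ) := by
  rw [th10]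
  refine ((hasSum_jacobiTheta₂_term (τ / 2) hτ).mul_left
    (Complex.exp (Real.pi * Complex.I * τ / 4))).congr_fun fun n => ?_
  rw [jacobiTheta₂_term, ← Complex.exp_add]
  congr 1
  ring

lemma theta_zero_zero (τ : ℍ) : theta 0 0 τ = th00 τ := by
  rw [← (hasSum_th00 τ.im_pos).tsum_eq, theta]
  simp

lemma theta_one_zero (τ : ℍ) : theta 1 0 τ = th10 τ := by
  rw [← (hasSum_th10 τ.im_pos).tsum_eq, theta]
  simp

/-- Since n² ≡ n mod 2, the extra factor exp(πi n²) is exp(πi n), which a half shift of z also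
produces. -/
lemma jacobiTheta₂_add_one_right (z τ : ℂ) :
    jacobiTheta₂ z (τ + 1) = jacobiTheta₂ (z + 1 / 2) τ := by
  refine tsum_congr fun n => ?_
  simp_rw [jacobiTheta₂_term]
  rw [Complex.exp_eq_exp_iff_exists_int]
  obtain ⟨k, hk⟩ := Int.even_mul_pred_self n
  refine ⟨k, ?_⟩
  have : (n : ℂ) * (n - 1) = k + k := by exact_mod_cast hk
  linear_combination Real.pi * Complex.I * this

lemma th00_add_one (τ : ℂ) : th00 (τ + 1) = th01 τ := by
  rw [th00, jacobiTheta₂_add_one_right, zero_add, th01]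

lemma th01_add_one (τ : ℂ) : th01 (τ + 1) = th00 τ := by
  rw [th01, jacobiTheta₂_add_one_right, show (1 / 2 + 1 / 2 : ℂ) = 0 + 1 by norm_num,
    jacobiTheta₂_add_left, th00]

lemma th10_add_one (τ : ℂ) :
    th10 (τ + 1) = Complex.exp (Real.pi * Complex.I / 4) * th10 τ := by
  rw [th10, jacobiTheta₂_add_one_right, show (τ + 1) / 2 + 1 / 2 = τ / 2 + 1 by ring,
    jacobiTheta₂_add_left, th10, ← mul_assoc, ← Complex.exp_add]
  congr 2
  ring

lemma th10_add_one_pow_four (τ : ℂ) : th10 (τ + 1) ^ 4 = -th10 τ ^ 4 := by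
  rw [th10_add_one, mul_pow, ← Complex.exp_nat_mul,
    show ((4 : ℕ) : ℂ) * (Real.pi * Complex.I / 4) = Real.pi * Complex.I by push_cast; ring,
    Complex.exp_pi_mul_I]
  ring

lemma im_neg_inv_pos {τ : ℂ} (hτ : 0 < τ.im) : 0 < (-1 / τ).im := by
  have h0 : τ ≠ 0 := by rintro rfl; simp at hτ
  rw [neg_div, one_div, Complex.neg_im, Complex.inv_im]
  have := Complex.normSq_pos.2 h0
  rw [neg_div, neg_neg]
  positivity

lemma ne_zero_of_im_pos {τ : ℂ} (hτ : 0 < τ.im) : τ ≠ 0 := by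
  rintro rfl; simp at hτ

lemma cpow_half_sq {w : ℂ} : (w ^ (1 / 2 : ℂ)) ^ 2 = w := by
  rw [← Complex.cpow_nat_mul]
  norm_num

lemma cpow_half_ne_zero {τ : ℂ} (hτ : τ ≠ 0) : (-Complex.I * τ) ^ (1 / 2 : ℂ) ≠ 0 := by
  rw [Ne, Complex.cpow_eq_zero_iff, not_and_or]
  exact Or.inl <| mul_ne_zero (neg_ne_zero.mpr Complex.I_ne_zero) hτ

lemma th00_neg_inv {τ : ℂ} (hτ : 0 < τ.im) :
    th00 (-1 / τ) = (-Complex.I * τ) ^ (1 / 2 : ℂ) * th00 τ := by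
  have h0 := cpow_half_ne_zero (ne_zero_of_im_pos hτ)
  rw [th00, th00, jacobiTheta₂_functional_equation 0 τ]
  simp only [zero_div, ne_eq, OfNat.ofNat_ne_zero, not_false_eq_true, zero_pow, mul_zero,
    Complex.exp_zero, mul_one]
  rw [← mul_assoc, mul_one_div_cancel h0, one_mul]

/-- The Gaussian factor in the functional equation at z = 1/2 is exactly the exponential prefactor
of `th10` at -1/τ. -/
lemma th10_neg_inv {τ : ℂ} (hτ : 0 < τ.im) :
    th10 (-1 / τ) = (-Complex.I * τ) ^ (1 / 2 : ℂ) * th01 τ := by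
  have h1 := ne_zero_of_im_pos hτ
  have h0 := cpow_half_ne_zero h1
  rw [th10, th01, jacobiTheta₂_functional_equation (1 / 2) τ,
    show -1 / τ / 2 = -(1 / 2 / τ) by field_simp, jacobiTheta₂_neg_left,
    show -Real.pi * Complex.I * (1 / 2) ^ 2 / τ = Real.pi * Complex.I * (-1 / τ) / 4 by
      field_simp; norm_num]
  generalize jacobiTheta₂ (1 / 2 / τ) (-1 / τ) = X
  generalize Complex.exp (Real.pi * Complex.I * (-1 / τ) / 4) = Y
  field_simp

lemma th00_sq_neg_inv {τ : ℂ} (hτ : 0 < τ.im) :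
    th00 (-1 / τ) ^ 2 = -Complex.I * τ * th00 τ ^ 2 := by
  rw [th00_neg_inv hτ, mul_pow, cpow_half_sq]

lemma th10_sq_neg_inv {τ : ℂ} (hτ : 0 < τ.im) :
    th10 (-1 / τ) ^ 2 = -Complex.I * τ * th01 τ ^ 2 := by
  rw [th10_neg_inv hτ, mul_pow, cpow_half_sq]

lemma differentiableAt_th00 {τ : ℂ} (hτ : 0 < τ.im) : DifferentiableAt ℂ th00 τ :=
  differentiableAt_jacobiTheta₂_snd 0 hτ

lemma differentiableAt_th10 {τ : ℂ} (hτ : 0 < τ.im) : DifferentiableAt ℂ th10 τ := by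
  have h : DifferentiableAt ℂ (fun s : ℂ => jacobiTheta₂ (s / 2) s) τ := by
    have h1 : DifferentiableAt ℂ (fun p : ℂ × ℂ => jacobiTheta₂ p.1 p.2) (τ / 2, τ) :=
      (hasFDerivAt_jacobiTheta₂ (τ / 2) hτ).differentiableAt
    exact h1.comp τ (f := fun s : ℂ => (s / 2, s)) (by fun_prop)
  have h2 : DifferentiableAt ℂ (fun s : ℂ => Complex.exp (Real.pi * Complex.I * s / 4)) τ := by
    fun_prop
  exact h2.mul h

/-! ### Duplication formulas -/

/-- A double sum over `ℤ²` split according to the parity of the sum of the two indices. -/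
lemma tsum_int_prod_parity {f : ℤ × ℤ → ℂ} (hf : Summable f) :
    ∑' p, f p = ∑' p : ℤ × ℤ, f (p.1 + p.2, p.1 - p.2)
      + ∑' p : ℤ × ℤ, f (p.1 + p.2 + 1, p.1 - p.2) := by
  set a : ℤ × ℤ → ℤ × ℤ := fun p => (p.1 + p.2, p.1 - p.2)
  set b : ℤ × ℤ → ℤ × ℤ := fun p => (p.1 + p.2 + 1, p.1 - p.2)
  have ha : Function.Injective a := by
    rintro ⟨x, y⟩ ⟨x', y'⟩ h
    simp only [a, Prod.mk.injEq] at h ⊢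
    omega
  have hb : Function.Injective b := by
    rintro ⟨x, y⟩ ⟨x', y'⟩ h
    simp only [b, Prod.mk.injEq] at h ⊢
    omega
  have hc : IsCompl (range a) (range b) := by
    constructor
    · rw [Set.disjoint_iff_forall_ne]
      rintro _ ⟨⟨x, y⟩, rfl⟩ _ ⟨⟨x', y'⟩, rfl⟩ h
      simp only [a, b, Prod.mk.injEq] at h
      omega
    · rw [codisjoint_iff_le_sup]
      rintro ⟨m, n⟩ -
      rcases Int.even_or_odd (m + n) with ⟨k, hk⟩ | ⟨k, hk⟩
      · left
        exact ⟨(k, m - k), by simp only [a, Prod.mk.injEq]; omega⟩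
      · right
        exact ⟨(k, m - 1 - k), by simp only [b, Prod.mk.injEq]; omega⟩
  have h1 : HasSum (f ∘ ((↑) : range a → ℤ × ℤ)) (∑' p, f (a p)) :=
    (ha.hasSum_range_iff).2 (hf.comp_injective ha).hasSum
  have h2 : HasSum (f ∘ ((↑) : range b → ℤ × ℤ)) (∑' p, f (b p)) :=
    (hb.hasSum_range_iff).2 (hf.comp_injective hb).hasSum
  exact (h1.add_isCompl hc h2).tsum_eq

/-- For quadratic exponents this passes from τ to 2τ: (a+b)² + (a-b)² = 2a² + 2b², and (a+b+1)² +
(a-b)² = 2(a+1/2)² + 2(b+1/2)². -/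
lemma tsum_mul_parity {f g : ℤ → ℂ} {a b : ℂ} (hf : HasSum f a) (hg : HasSum g b) :
    a * b = ∑' p : ℤ × ℤ, f (p.1 + p.2) * g (p.1 - p.2)
      + ∑' p : ℤ × ℤ, f (p.1 + p.2 + 1) * g (p.1 - p.2) := by
  have h := tsum_mul_tsum_of_summable_norm hf.summable.norm hg.summable.norm
  rw [hf.tsum_eq, hg.tsum_eq] at h
  rw [h, tsum_int_prod_parity (summable_mul_of_summable_norm hf.summable.norm hg.summable.norm)]

lemma hasSum_mul_eq_tsum {f g : ℤ → ℂ} {a b : ℂ} (hf : HasSum f a) (hg : HasSum g b) :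
    a * b = ∑' p : ℤ × ℤ, f p.1 * g p.2 := by
  rw [← hf.tsum_eq, ← hg.tsum_eq]
  exact tsum_mul_tsum_of_summable_norm hf.summable.norm hg.summable.norm

lemma two_mul_im_pos {τ : ℂ} (hτ : 0 < τ.im) : 0 < (2 * τ).im := by simpa using hτ

lemma exp_add_int_mul_pi_I (a b : ℂ) (k : ℤ) (h : a = b + 2 * k * (Real.pi * Complex.I)) :
    Complex.exp a = Complex.exp b :=
  Complex.exp_eq_exp_iff_exists_int.2 ⟨k, by rw [h]; ring⟩

lemma exp_add_odd_mul_pi_I (a b : ℂ) (k : ℤ)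
    (h : a = b + (2 * k + 1) * (Real.pi * Complex.I)) :
    Complex.exp a = -Complex.exp b := by
  rw [exp_add_int_mul_pi_I a (b + Real.pi * Complex.I) k (by rw [h]; ring), Complex.exp_add,
    Complex.exp_pi_mul_I]
  ring

lemma th00_sq {τ : ℂ} (hτ : 0 < τ.im) :
    th00 τ ^ 2 = th00 (2 * τ) ^ 2 + th10 (2 * τ) ^ 2 := by
  rw [sq, sq, sq, tsum_mul_parity (hasSum_th00 hτ) (hasSum_th00 hτ),
    hasSum_mul_eq_tsum (hasSum_th00 (two_mul_im_pos hτ)) (hasSum_th00 (two_mul_im_pos hτ)),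
    hasSum_mul_eq_tsum (hasSum_th10 (two_mul_im_pos hτ)) (hasSum_th10 (two_mul_im_pos hτ))]
  congr 1 <;> refine tsum_congr fun p => ?_ <;> rw [← Complex.exp_add, ← Complex.exp_add] <;>
    push_cast <;> congr 1 <;> ring

lemma th01_sq {τ : ℂ} (hτ : 0 < τ.im) :
    th01 τ ^ 2 = th00 (2 * τ) ^ 2 - th10 (2 * τ) ^ 2 := by
  rw [sq, sq, sq, tsum_mul_parity (hasSum_th01 hτ) (hasSum_th01 hτ),
    hasSum_mul_eq_tsum (hasSum_th00 (two_mul_im_pos hτ)) (hasSum_th00 (two_mul_im_pos hτ)),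
    hasSum_mul_eq_tsum (hasSum_th10 (two_mul_im_pos hτ)) (hasSum_th10 (two_mul_im_pos hτ)),
    sub_eq_add_neg, ← tsum_neg]
  congr 1 <;> refine tsum_congr fun p => ?_ <;> rw [← Complex.exp_add, ← Complex.exp_add] <;>
    push_cast
  · exact exp_add_int_mul_pi_I _ _ p.1 (by ring)
  · exact exp_add_odd_mul_pi_I _ _ p.1 (by ring)

lemma th00_mul_th01 {τ : ℂ} (hτ : 0 < τ.im) : th00 τ * th01 τ = th01 (2 * τ) ^ 2 := by
  rw [sq, tsum_mul_parity (hasSum_th00 hτ) (hasSum_th01 hτ),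
    hasSum_mul_eq_tsum (hasSum_th01 (two_mul_im_pos hτ)) (hasSum_th01 (two_mul_im_pos hτ))]
  -- The odd half of the double sum vanishes: the substitution b ↦ -1 - b swaps the two squares and
  -- flips the sign.
  have h : ∀ S : ℂ, S = -S → S = 0 := fun S hS => by linear_combination hS / 2
  rw [h (∑' p : ℤ × ℤ, Complex.exp (Real.pi * Complex.I * ((p.1 + p.2 + 1 : ℤ) : ℂ) ^ 2 * τ) *
    Complex.exp (Real.pi * Complex.I * ((p.1 - p.2 : ℤ) : ℂ) +
      Real.pi * Complex.I * ((p.1 - p.2 : ℤ) : ℂ) ^ 2 * τ)), add_zero]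
  · refine tsum_congr fun p => ?_
    rw [← Complex.exp_add, ← Complex.exp_add]
    push_cast
    exact exp_add_int_mul_pi_I _ _ (-p.2) (by push_cast; ring)
  · conv_lhs => rw [← (Equiv.prodCongr (Equiv.refl ℤ) (Equiv.subLeft (-1 : ℤ))).tsum_eq]
    rw [← tsum_neg]
    refine tsum_congr fun p => ?_
    rw [← Complex.exp_add, ← Complex.exp_add]
    simp only [Equiv.prodCongr_apply, Prod.map_fst, Prod.map_snd, Equiv.refl_apply,
      Equiv.subLeft_apply]
    push_cast
    exact exp_add_odd_mul_pi_I _ _ p.2 (by ring)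

lemma th10_sq {τ : ℂ} (hτ : 0 < τ.im) :
    th10 τ ^ 2 = 2 * th00 (2 * τ) * th10 (2 * τ) := by
  rw [sq, tsum_mul_parity (hasSum_th10 hτ) (hasSum_th10 hτ),
    show 2 * th00 (2 * τ) * th10 (2 * τ)
      = th00 (2 * τ) * th10 (2 * τ) + th10 (2 * τ) * th00 (2 * τ) by ring,
    hasSum_mul_eq_tsum (hasSum_th00 (two_mul_im_pos hτ)) (hasSum_th10 (two_mul_im_pos hτ)),
    hasSum_mul_eq_tsum (hasSum_th10 (two_mul_im_pos hτ)) (hasSum_th00 (two_mul_im_pos hτ)),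
    add_comm]
  congr 1
  -- The odd half has exponent 2(a+1)² + 2(b+1/2)²; shifting the first index absorbs the a + 1.
  · rw [← (Equiv.prodCongr (Equiv.addRight (1 : ℤ)) (Equiv.refl ℤ)).tsum_eq
      (fun p : ℤ × ℤ => Complex.exp (Real.pi * Complex.I * (p.1 : ℂ) ^ 2 * (2 * τ)) *
        Complex.exp (Real.pi * Complex.I * ((p.2 : ℂ) + 1 / 2) ^ 2 * (2 * τ)))]
    refine tsum_congr fun p => ?_
    rw [← Complex.exp_add, ← Complex.exp_add]
    simp only [Equiv.prodCongr_apply, Prod.map_fst, Prod.map_snd, Equiv.refl_apply,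
      Equiv.coe_addRight]
    push_cast
    congr 1
    ring
  · refine tsum_congr fun p => ?_
    rw [← Complex.exp_add, ← Complex.exp_add]
    push_cast
    congr 1
    ring

/-- Jacobi's quartic identity. -/
lemma th00_pow_four {τ : ℂ} (hτ : 0 < τ.im) : th00 τ ^ 4 = th01 τ ^ 4 + th10 τ ^ 4 := by
  have h1 := th00_sq hτ
  have h2 := th01_sq hτ
  have h3 := th10_sq hτ
  calc th00 τ ^ 4 = (th00 τ ^ 2) ^ 2 := by ring
    _ = (th01 τ ^ 2) ^ 2 + (th10 τ ^ 2) ^ 2 := by rw [h1, h2, h3]; ring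
    _ = _ := by ring

/-! ### Behaviour at the cusp and nonvanishing -/

lemma tendsto_th00 : Tendsto th00 (comap Complex.im atTop) (𝓝 1) := by
  rw [tendsto_iff_norm_sub_tendsto_zero]
  have h : Tendsto (fun y : ℝ => 2 / (1 - Real.exp (-Real.pi * y)) * Real.exp (-Real.pi * y))
      atTop (𝓝 0) := by
    have h0 : Tendsto (fun y : ℝ => Real.exp (-Real.pi * y)) atTop (𝓝 0) :=
      Real.tendsto_exp_atBot.comp (tendsto_id.const_mul_atTop_of_neg (by simp [Real.pi_pos]))
    have h1 : Tendsto (fun y : ℝ => 2 / (1 - Real.exp (-Real.pi * y))) atTop (𝓝 (2 / (1 - 0))) :=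
      tendsto_const_nhds.div (tendsto_const_nhds.sub h0) (by norm_num)
    simpa using h1.mul h0
  refine squeeze_zero' (Eventually.of_forall fun _ => norm_nonneg _) ?_ (h.comp tendsto_comap)
  filter_upwards [tendsto_comap.eventually (eventually_gt_atTop 0)] with τ hτ
  rw [th00, ← jacobiTheta_eq_jacobiTheta₂]
  exact norm_jacobiTheta_sub_one_le hτ

lemma tendsto_add_real_comap_im (a : ℂ) (ha : a.im = 0) :
    Tendsto (fun τ : ℂ => τ + a) (comap Complex.im atTop) (comap Complex.im atTop) := by
  rw [tendsto_comap_iff]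
  refine tendsto_comap.congr fun τ => ?_
  simp [ha]

lemma tendsto_th01 : Tendsto th01 (comap Complex.im atTop) (𝓝 1) := by
  refine (tendsto_th00.comp (tendsto_add_real_comap_im 1 (by simp))).congr fun τ => ?_
  simp [th00_add_one]

lemma tendsto_two_pow_mul {τ : ℂ} (hτ : 0 < τ.im) :
    Tendsto (fun n : ℕ => (2 : ℂ) ^ n * τ) atTop (comap Complex.im atTop) := by
  rw [tendsto_comap_iff]
  have h : Tendsto (fun n : ℕ => (2 : ℝ) ^ n * τ.im) atTop atTop :=
    (tendsto_pow_atTop_atTop_of_one_lt one_lt_two).atTop_mul_const hτ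
  refine h.congr fun n => ?_
  have : ((2 : ℂ) ^ n) = ((2 ^ n : ℝ) : ℂ) := by push_cast; rfl
  simp only [Function.comp_apply]
  rw [this, Complex.im_ofReal_mul]

lemma two_pow_mul_im_pos {τ : ℂ} (hτ : 0 < τ.im) (n : ℕ) : 0 < ((2 : ℂ) ^ n * τ).im := by
  have : ((2 : ℂ) ^ n) = ((2 ^ n : ℝ) : ℂ) := by push_cast; rfl
  rw [this, Complex.im_ofReal_mul]
  positivity

/-- By `th00_mul_th01` a zero at τ forces zeros at every 2ⁿτ, against the limit 1 at the cusp i∞. -/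
lemma th01_ne_zero {τ : ℂ} (hτ : 0 < τ.im) : th01 τ ≠ 0 := by
  intro h
  have key : ∀ n : ℕ, th01 (2 ^ n * τ) = 0 := by
    intro n
    induction n with
    | zero => simpa using h
    | succ n ih =>
      have := th00_mul_th01 (two_pow_mul_im_pos hτ n)
      rw [ih, mul_zero] at this
      rw [pow_succ', mul_assoc]
      exact pow_eq_zero_iff (two_ne_zero) |>.1 this.symm
  have h1 := tendsto_th01.comp (tendsto_two_pow_mul hτ)
  have h2 : Tendsto (th01 ∘ fun n : ℕ => (2 : ℂ) ^ n * τ) atTop (𝓝 0) :=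
    tendsto_const_nhds.congr fun n => (key n).symm
  exact one_ne_zero (tendsto_nhds_unique h1 h2)

lemma th00_ne_zero {τ : ℂ} (hτ : 0 < τ.im) : th00 τ ≠ 0 := by
  rw [← th01_add_one]
  exact th01_ne_zero (by simpa using hτ)

lemma th10_ne_zero {τ : ℂ} (hτ : 0 < τ.im) : th10 τ ≠ 0 := by
  have h := th10_neg_inv (im_neg_inv_pos hτ)
  have h1 := ne_zero_of_im_pos hτ
  rw [show -1 / (-1 / τ) = τ by field_simp] at h
  rw [h]
  exact mul_ne_zero (cpow_half_ne_zero (ne_zero_of_im_pos (im_neg_inv_pos hτ)))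
    (th01_ne_zero (im_neg_inv_pos hτ))

/-! ### The lambda function on the upper half of `ℂ` -/

/-- The lambda function as a function on `ℂ`. -/
noncomputable def lamC (τ : ℂ) : ℂ := th10 τ ^ 4 / th00 τ ^ 4

lemma lam_eq_lamC (τ : ℍ) : lam τ = lamC τ := by
  rw [lam, lamC, theta_zero_zero, theta_one_zero]

lemma one_sub_lamC {τ : ℂ} (hτ : 0 < τ.im) : 1 - lamC τ = th01 τ ^ 4 / th00 τ ^ 4 := by
  have := th00_ne_zero hτ
  rw [lamC, eq_div_iff (pow_ne_zero _ this), sub_mul, div_mul_cancel₀ _ (pow_ne_zero _ this)]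
  linear_combination th00_pow_four hτ

lemma lamC_ne_zero {τ : ℂ} (hτ : 0 < τ.im) : lamC τ ≠ 0 :=
  div_ne_zero (pow_ne_zero _ (th10_ne_zero hτ)) (pow_ne_zero _ (th00_ne_zero hτ))

lemma one_sub_lamC_ne_zero {τ : ℂ} (hτ : 0 < τ.im) : 1 - lamC τ ≠ 0 := by
  rw [one_sub_lamC hτ]
  exact div_ne_zero (pow_ne_zero _ (th01_ne_zero hτ)) (pow_ne_zero _ (th00_ne_zero hτ))

lemma lamC_ne_one {τ : ℂ} (hτ : 0 < τ.im) : lamC τ ≠ 1 :=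
  fun h => one_sub_lamC_ne_zero hτ (by rw [h, sub_self])

lemma lamC_add_one {τ : ℂ} (hτ : 0 < τ.im) : lamC (τ + 1) = lamC τ / (lamC τ - 1) := by
  have h1 := th00_ne_zero hτ
  have h2 := th01_ne_zero hτ
  have h3 : lamC τ - 1 = -(th01 τ ^ 4 / th00 τ ^ 4) := by rw [← one_sub_lamC hτ]; ring
  rw [h3, lamC, lamC, th10_add_one_pow_four, th00_add_one]
  field_simp

lemma lamC_add_two (τ : ℂ) : lamC (τ + 2) = lamC τ := by
  rw [show τ + 2 = τ + 1 + 1 by ring, lamC, lamC, th10_add_one_pow_four, th10_add_one_pow_four,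
    th00_add_one, th01_add_one, neg_neg]

lemma lamC_sub_two (τ : ℂ) : lamC (τ - 2) = lamC τ := by
  rw [← lamC_add_two (τ - 2), sub_add_cancel]

lemma lamC_neg_inv {τ : ℂ} (hτ : 0 < τ.im) : lamC (-1 / τ) = 1 - lamC τ := by
  have h := ne_zero_of_im_pos hτ
  have h1 := th00_ne_zero hτ
  have e : ∀ x : ℂ, x ^ 4 = (x ^ 2) ^ 2 := fun x => by ring
  rw [one_sub_lamC hτ, lamC, e, e (th00 (-1 / τ)), th00_sq_neg_inv hτ, th10_sq_neg_inv hτ,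
    mul_pow _ (th01 τ ^ 2), mul_pow _ (th00 τ ^ 2), mul_div_mul_left]
  · ring
  · exact pow_ne_zero _ (mul_ne_zero (neg_ne_zero.2 Complex.I_ne_zero) h)

/-- The substitution 1 - 1/τ moves the cusp 0 to i∞, and -1/(τ - 1) in the next lemma does the same
for the cusp 1. They bring estimates near these cusps back to the expansion at i∞. -/
lemma lamC_one_sub_inv {τ : ℂ} (hτ : 0 < τ.im) : lamC (-1 / τ + 1) = 1 - 1 / lamC τ := by
  have h := lamC_ne_zero hτ
  rw [lamC_add_one (im_neg_inv_pos hτ), lamC_neg_inv hτ,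
    show 1 - lamC τ - 1 = -lamC τ by ring]
  field_simp
  ring

lemma lamC_neg_inv_sub_one {τ : ℂ} (hτ : 0 < τ.im) :
    lamC (-1 / (τ - 1)) = 1 / (1 - lamC τ) := by
  have hs : 0 < (τ - 1).im := by simpa using hτ
  have h := one_sub_lamC_ne_zero hτ
  have h1 : lamC (τ - 1) = lamC τ / (lamC τ - 1) := by
    rw [← lamC_add_one hτ, ← lamC_sub_two (τ + 1)]
    congr 1
    ring
  have h2 : lamC τ - 1 ≠ 0 := by rw [← neg_sub]; exact neg_ne_zero.2 h
  rw [lamC_neg_inv hs, h1]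
  field_simp
  ring

lemma differentiableAt_lamC {τ : ℂ} (hτ : 0 < τ.im) : DifferentiableAt ℂ lamC τ :=
  ((differentiableAt_th10 hτ).pow 4).div ((differentiableAt_th00 hτ).pow 4)
    (pow_ne_zero _ (th00_ne_zero hτ))

lemma isOpen_im_pos : IsOpen {τ : ℂ | 0 < τ.im} := isOpen_lt continuous_const Complex.continuous_im

lemma analyticOnNhd_lamC : AnalyticOnNhd ℂ lamC {τ : ℂ | 0 < τ.im} :=
  DifferentiableOn.analyticOnNhd
    (fun _ h => (differentiableAt_lamC h).differentiableWithinAt) isOpen_im_pos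

lemma analyticOnNhd_th00 : AnalyticOnNhd ℂ th00 {τ : ℂ | 0 < τ.im} :=
  DifferentiableOn.analyticOnNhd
    (fun _ h => (differentiableAt_th00 h).differentiableWithinAt) isOpen_im_pos

/-! ### Reflection -/

open scoped ComplexConjugate

lemma th00_neg_conj (τ : ℂ) : th00 (-conj τ) = conj (th00 τ) := by
  rw [th00, th00, jacobiTheta₂_conj, map_zero]

lemma th01_neg_conj (τ : ℂ) : th01 (-conj τ) = conj (th01 τ) := by
  rw [th01, th01, jacobiTheta₂_conj]
  simp [Complex.conj_ofNat]

lemma th10_neg_conj (τ : ℂ) : th10 (-conj τ) = conj (th10 τ) := by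
  rw [th10, th10, map_mul, jacobiTheta₂_conj, ← Complex.exp_conj, neg_div, jacobiTheta₂_neg_left]
  simp [Complex.conj_ofNat]

lemma lamC_neg_conj (τ : ℂ) : lamC (-conj τ) = conj (lamC τ) := by
  rw [lamC, lamC, th00_neg_conj, th10_neg_conj]
  simp

lemma neg_conj_of_re_eq_zero {τ : ℂ} (h : τ.re = 0) : -conj τ = τ := by
  apply Complex.ext <;> simp [h]

lemma lamC_im_of_re_eq_zero {τ : ℂ} (h : τ.re = 0) : (lamC τ).im = 0 := by
  rw [← Complex.conj_eq_iff_im, ← lamC_neg_conj, neg_conj_of_re_eq_zero h]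

/-- The reflection τ ↦ -conj τ acts on this line as translation by 2, a period of λ. -/
lemma lamC_im_of_re_eq_neg_one {τ : ℂ} (h : τ.re = -1) : (lamC τ).im = 0 := by
  rw [← Complex.conj_eq_iff_im, ← lamC_neg_conj, ← lamC_add_two τ]
  congr 1
  apply Complex.ext <;> simp [h]
  norm_num

lemma lamC_im_of_re_eq_one {τ : ℂ} (h : τ.re = 1) : (lamC τ).im = 0 := by
  rw [← lamC_sub_two]
  exact lamC_im_of_re_eq_neg_one (by simp [h]; norm_num)

lemma exists_ofReal_of_conj_eq {z : ℂ} (h : conj z = z) : ∃ r : ℝ, z = r :=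
  (Complex.conj_eq_iff_real.1 h)

/-- On the imaginary axis the theta constants are real, and `0 < λ < 1`. -/
lemma lamC_of_re_eq_zero {τ : ℂ} (hτ : 0 < τ.im) (h : τ.re = 0) :
    ∃ r : ℝ, 0 < r ∧ r < 1 ∧ lamC τ = r := by
  have hc := neg_conj_of_re_eq_zero h
  obtain ⟨a, ha⟩ := exists_ofReal_of_conj_eq (z := th00 τ) (by rw [← th00_neg_conj, hc])
  obtain ⟨b, hb⟩ := exists_ofReal_of_conj_eq (z := th01 τ) (by rw [← th01_neg_conj, hc])
  obtain ⟨c, hd⟩ := exists_ofReal_of_conj_eq (z := th10 τ) (by rw [← th10_neg_conj, hc])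
  have ha0 : a ≠ 0 := fun h => th00_ne_zero hτ (by rw [ha, h, Complex.ofReal_zero])
  have hb0 : b ≠ 0 := fun h => th01_ne_zero hτ (by rw [hb, h, Complex.ofReal_zero])
  have hc0 : c ≠ 0 := fun h => th10_ne_zero hτ (by rw [hd, h, Complex.ofReal_zero])
  have e1 : lamC τ = ((c ^ 4 / a ^ 4 : ℝ) : ℂ) := by rw [lamC, ha, hd]; push_cast; rfl
  have e2 : 1 - lamC τ = ((b ^ 4 / a ^ 4 : ℝ) : ℂ) := by
    rw [one_sub_lamC hτ, ha, hb]; push_cast; rfl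
  refine ⟨_, by positivity, ?_, e1⟩
  rw [e1, ← Complex.ofReal_one, ← Complex.ofReal_sub, Complex.ofReal_inj] at e2
  have : 0 < b ^ 4 / a ^ 4 := by positivity
  linarith

/-! ### Expansion at the cusp -/

/-- `∑ q ^ (n ^ 2)`, so that `ϑ₀₀` is this function of the nome. -/
noncomputable def qTh00 (q : ℂ) : ℂ := ∑' n : ℤ, q ^ (n ^ 2).toNat

/-- `∑ q ^ (n (n + 1))`, so that `ϑ₁₀` is `q ^ (1 / 4)` times this function of the nome. -/
noncomputable def qTh10 (q : ℂ) : ℂ := ∑' n : ℤ, q ^ (n * (n + 1)).toNat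

/-- The slack of one in the growth condition is needed for the exponent n(n + 1), which vanishes at
n = -1. -/
lemma summable_half_pow {k : ℤ → ℕ} (h : ∀ n : ℤ, n.natAbs ≤ k n + 1) :
    Summable fun n : ℤ => (1 / 2 : ℝ) ^ k n := by
  have h1 : Summable fun n : ℕ => 2 * (1 / 2 : ℝ) ^ n :=
    (summable_geometric_of_lt_one (by norm_num) (by norm_num)).mul_left 2
  have key : ∀ n : ℤ, (1 / 2 : ℝ) ^ k n ≤ 2 * (1 / 2 : ℝ) ^ n.natAbs := fun n => by
    have := pow_le_pow_of_le_one (a := (1 / 2 : ℝ)) (by norm_num) (by norm_num) (h n)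
    rw [pow_succ] at this
    linarith
  refine Summable.of_nonneg_of_le (fun n => by positivity) key
    (Summable.of_nat_of_neg (by simpa using h1) (by simpa using h1))

lemma differentiableOn_tsum_pow {k : ℤ → ℕ} (h : ∀ n : ℤ, n.natAbs ≤ k n + 1) :
    DifferentiableOn ℂ (fun q : ℂ => ∑' n : ℤ, q ^ k n) (Metric.ball 0 (1 / 2)) := by
  refine Complex.differentiableOn_tsum_of_summable_norm (summable_half_pow h)
    (fun n => by fun_prop) Metric.isOpen_ball fun n w hw => ?_
  rw [norm_pow]
  exact pow_le_pow_left₀ (norm_nonneg _) ((mem_ball_zero_iff.1 hw).le) _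

lemma analyticAt_qTh00 : AnalyticAt ℂ qTh00 0 := by
  refine (differentiableOn_tsum_pow fun n => ?_).analyticAt
    (Metric.ball_mem_nhds 0 (by norm_num))
  have h : n ≤ n ^ 2 := Int.le_self_sq n
  have h' : -n ≤ n ^ 2 := by simpa using Int.le_self_sq (-n)
  omega

lemma analyticAt_qTh10 : AnalyticAt ℂ qTh10 0 := by
  refine (differentiableOn_tsum_pow fun n => ?_).analyticAt
    (Metric.ball_mem_nhds 0 (by norm_num))
  have h : (n + 1) ≤ (n + 1) ^ 2 := Int.le_self_sq _
  have h' : -n ≤ n ^ 2 := by simpa using Int.le_self_sq (-n)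
  have e1 : n * (n + 1) = (n + 1) ^ 2 - (n + 1) := by ring
  have e2 : n * (n + 1) = n ^ 2 + n := by ring
  have h2 : n ≤ n ^ 2 := Int.le_self_sq n
  have h3 : 0 ≤ (n + 1) ^ 2 := sq_nonneg _
  rcases le_or_gt 0 n with hn | hn
  · omega
  · have : (-n - 1) * 1 ≤ (-n - 1) * (-n) := mul_le_mul_of_nonneg_left (by omega) (by omega)
    have e3 : (-n - 1) * (-n) = n * (n + 1) := by ring
    omega

lemma qTh00_zero : qTh00 0 = 1 := by
  rw [qTh00, tsum_eq_single 0]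
  · simp
  · intro n hn
    refine zero_pow fun h => hn ?_
    have : 0 ≤ n ^ 2 := sq_nonneg n
    exact pow_eq_zero_iff (two_ne_zero) |>.1 (by omega)

lemma qTh10_zero : qTh10 0 = 2 := by
  rw [qTh10, tsum_eq_sum (s := {0, -1})]
  · simp
    norm_num
  · intro n hn
    simp only [Finset.mem_insert, Finset.mem_singleton, not_or] at hn
    refine zero_pow fun h => ?_
    have h1 : n * (n + 1) ≤ 0 := by omega
    rcases le_or_gt 0 n with h0 | h0
    · have : 1 * 1 ≤ n * (n + 1) := mul_le_mul (by omega) (by omega) (by omega) (by omega)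
      omega
    · have : 1 * 1 ≤ (-n) * (-(n + 1)) := mul_le_mul (by omega) (by omega) (by omega) (by omega)
      have e : (-n) * (-(n + 1)) = n * (n + 1) := by ring
      omega

/-- The nome `q = exp(πiτ)`. -/
noncomputable def nome (τ : ℂ) : ℂ := Complex.exp (Real.pi * Complex.I * τ)

lemma th00_eq_qTh00 {τ : ℂ} (hτ : 0 < τ.im) : th00 τ = qTh00 (nome τ) := by
  rw [← (hasSum_th00 hτ).tsum_eq, qTh00]
  refine tsum_congr fun n => ?_
  rw [nome, ← Complex.exp_nat_mul]
  have : (((n ^ 2).toNat : ℕ) : ℂ) = (n : ℂ) ^ 2 := by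
    have := Int.toNat_of_nonneg (sq_nonneg n)
    exact_mod_cast congrArg (Int.cast : ℤ → ℂ) this
  rw [this]
  congr 1
  ring

lemma int_mul_succ_nonneg (n : ℤ) : 0 ≤ n * (n + 1) := by
  rcases le_or_gt 0 n with h | h
  · positivity
  · exact mul_nonneg_of_nonpos_of_nonpos (by omega) (by omega)

lemma th10_eq_qTh10 {τ : ℂ} (hτ : 0 < τ.im) :
    th10 τ = Complex.exp (Real.pi * Complex.I * τ / 4) * qTh10 (nome τ) := by
  rw [← (hasSum_th10 hτ).tsum_eq, qTh10, ← tsum_mul_left]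
  refine tsum_congr fun n => ?_
  rw [nome, ← Complex.exp_nat_mul, ← Complex.exp_add]
  have : (((n * (n + 1)).toNat : ℕ) : ℂ) = (n : ℂ) * (n + 1) := by
    have := Int.toNat_of_nonneg (int_mul_succ_nonneg n)
    exact_mod_cast congrArg (Int.cast : ℤ → ℂ) this
  rw [this]
  congr 1
  ring

/-- The lambda function in terms of the nome. -/
noncomputable def qLam (q : ℂ) : ℂ := q * (qTh10 q ^ 4 / qTh00 q ^ 4)

lemma lamC_eq_qLam {τ : ℂ} (hτ : 0 < τ.im) : lamC τ = qLam (nome τ) := by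
  rw [lamC, qLam, th00_eq_qTh00 hτ, th10_eq_qTh10 hτ, mul_pow, ← Complex.exp_nat_mul, mul_div_assoc,
    nome]
  congr 2
  push_cast
  ring

/-- The constant is 2⁴, from the values of the two series at q = 0. Strict differentiability serves
to compare λ at the two nearby nomes q and conj q. -/
lemma hasStrictDerivAt_qLam : HasStrictDerivAt qLam 16 0 := by
  have h1 : AnalyticAt ℂ (fun q => qTh10 q ^ 4 / qTh00 q ^ 4) 0 :=
    (analyticAt_qTh10.pow 4).div (analyticAt_qTh00.pow 4) (by simp [qTh00_zero])
  have h2 := (hasStrictDerivAt_id (0 : ℂ)).mul h1.hasStrictDerivAt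
  have h3 : 1 * (qTh10 0 ^ 4 / qTh00 0 ^ 4)
      + id 0 * deriv (fun q => qTh10 q ^ 4 / qTh00 q ^ 4) 0 = 16 := by
    rw [qTh00_zero, qTh10_zero, id_eq, zero_mul]
    norm_num
  rw [h3] at h2
  exact h2

lemma norm_nome (τ : ℂ) : ‖nome τ‖ = Real.exp (-Real.pi * τ.im) := by
  rw [nome, Complex.norm_exp]
  simp

lemma nome_neg_conj (τ : ℂ) : nome (-conj τ) = conj (nome τ) := by
  rw [nome, nome, ← Complex.exp_conj]
  simp

lemma tendsto_nome : Tendsto nome (comap Complex.im atTop) (𝓝 0) := by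
  rw [tendsto_zero_iff_norm_tendsto_zero]
  have h0 : Tendsto (fun y : ℝ => Real.exp (-Real.pi * y)) atTop (𝓝 0) :=
    Real.tendsto_exp_atBot.comp (tendsto_id.const_mul_atTop_of_neg (by simp [Real.pi_pos]))
  exact (h0.comp tendsto_comap).congr fun τ => (norm_nome τ).symm

lemma tendsto_lamC : Tendsto lamC (comap Complex.im atTop) (𝓝 0) := by
  have h := hasStrictDerivAt_qLam.hasDerivAt.continuousAt.tendsto.comp tendsto_nome
  rw [show qLam 0 = 0 by simp [qLam]] at h
  refine h.congr' ?_
  filter_upwards [tendsto_comap.eventually (eventually_gt_atTop 0)] with τ hτ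
  exact (lamC_eq_qLam hτ).symm

lemma nome_im_nonneg {τ : ℂ} (h0 : 0 ≤ τ.re) (h1 : τ.re ≤ 1) : 0 ≤ (nome τ).im := by
  rw [nome, Complex.exp_im]
  refine mul_nonneg (Real.exp_pos _).le (Real.sin_nonneg_of_nonneg_of_le_pi ?_ ?_)
  · simp; positivity
  · simp; nlinarith [Real.pi_pos]

lemma exists_lamC_im_nonneg_of_le_im :
    ∃ Y : ℝ, 1 ≤ Y ∧ ∀ τ : ℂ, 0 ≤ τ.re → τ.re ≤ 1 → Y ≤ τ.im → 0 ≤ (lamC τ).im := by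
  -- At the pair (q, conj q) this reads |2 Im λ - 32 Im q| ≤ 16 Im q, so Im λ inherits the sign of
  -- Im q. Any positive constant up to 16 would serve in place of 8.
  have h := hasStrictDerivAt_qLam.hasStrictFDerivAt.isLittleO.def (show (0 : ℝ) < 8 by norm_num)
  have hc : Tendsto (fun q : ℂ => (q, conj q)) (𝓝 0) (𝓝 (0, 0)) := by
    have : ContinuousAt (fun q : ℂ => (q, conj q)) 0 :=
      continuousAt_id.prodMk Complex.continuous_conj.continuousAt
    simpa [ContinuousAt] using this
  have h2 := tendsto_nome.eventually (hc.eventually h)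
  rw [(atTop_basis.comap Complex.im).eventually_iff] at h2
  obtain ⟨Y, -, hY⟩ := h2
  refine ⟨max Y 1, le_max_right _ _, fun τ h0 h1 hτ => ?_⟩
  have hτ0 : 0 < τ.im := lt_of_lt_of_le one_pos ((le_max_right _ _).trans hτ)
  have h3 := hY (x := τ) ((le_max_left _ _).trans hτ)
  have hτ1 : 0 < (-conj τ).im := by simpa using hτ0
  rw [← lamC_eq_qLam hτ0, ← nome_neg_conj, ← lamC_eq_qLam hτ1, nome_neg_conj, lamC_neg_conj] at h3
  have h4 := (Complex.abs_im_le_norm _).trans h3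
  have h5 : nome τ - conj (nome τ) = ((2 * (nome τ).im : ℝ) : ℂ) * Complex.I := by
    apply Complex.ext <;> simp; ring
  have h6 := nome_im_nonneg h0 h1
  rw [h5, norm_mul, Complex.norm_real, Complex.norm_I] at h4
  simp at h4
  rw [abs_of_nonneg h6] at h4
  have := (abs_le.1 h4).1
  linarith

/-! ### The sign of the imaginary part -/

lemma lamC_im_nonneg_of_one_sub_inv {τ : ℂ} (hτ : 0 < τ.im)
    (h : 0 ≤ (lamC (-1 / τ + 1)).im) : 0 ≤ (lamC τ).im := by
  rw [lamC_one_sub_inv hτ] at h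
  have h0 := Complex.normSq_pos.2 (lamC_ne_zero hτ)
  simp only [one_div, Complex.sub_im, Complex.one_im, Complex.inv_im, zero_sub, neg_div,
    neg_neg] at h
  exact (div_nonneg_iff.1 h).elim And.left fun h => absurd h.2 h0.not_ge

lemma lamC_im_nonneg_of_neg_inv_sub_one {τ : ℂ} (hτ : 0 < τ.im)
    (h : 0 ≤ (lamC (-1 / (τ - 1))).im) : 0 ≤ (lamC τ).im := by
  rw [lamC_neg_inv_sub_one hτ] at h
  have h0 := Complex.normSq_pos.2 (one_sub_lamC_ne_zero hτ)
  simp only [one_div, Complex.sub_im, Complex.one_im, Complex.inv_im, zero_sub, neg_neg] at h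
  exact (div_nonneg_iff.1 h).elim And.left fun h => absurd h.2 h0.not_ge

lemma normSq_le_iff_norm_sub_half (τ : ℂ) :
    1 / 2 ≤ ‖τ - 1 / 2‖ ↔ τ.re ≤ τ.re ^ 2 + τ.im ^ 2 := by
  rw [← sq_le_sq₀ (by norm_num) (norm_nonneg _), Complex.sq_norm, Complex.normSq_apply]
  simp
  constructor <;> intro h <;> nlinarith

lemma normSq_lt_iff_norm_sub_half (τ : ℂ) :
    1 / 2 < ‖τ - 1 / 2‖ ↔ τ.re < τ.re ^ 2 + τ.im ^ 2 := by
  rw [← sq_lt_sq₀ (by norm_num) (norm_nonneg _), Complex.sq_norm, Complex.normSq_apply]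
  simp
  constructor <;> intro h <;> nlinarith

lemma neg_inv_re (τ : ℂ) : (-1 / τ).re = -(τ.re / (τ.re ^ 2 + τ.im ^ 2)) := by
  rw [neg_div, one_div, Complex.neg_re, Complex.inv_re, Complex.normSq_apply, sq, sq]

lemma neg_inv_im (τ : ℂ) : (-1 / τ).im = τ.im / (τ.re ^ 2 + τ.im ^ 2) := by
  rw [neg_div, one_div, Complex.neg_im, Complex.inv_im, Complex.normSq_apply, sq, sq, neg_div,
    neg_neg]

/-- Inversion carries the circle |τ - 1/2| = 1/2 to the line Re = -1, where λ is real, and replaces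
λ by 1 - λ. -/
lemma lamC_im_of_norm_sub_half_eq {τ : ℂ} (hτ : 0 < τ.im) (h : τ.re = τ.re ^ 2 + τ.im ^ 2) :
    (lamC τ).im = 0 := by
  have h1 := lamC_neg_inv hτ
  have h2 : (-1 / τ).re = -1 := by
    rw [neg_inv_re, ← h, div_self]
    have : 0 < τ.im ^ 2 := by positivity
    nlinarith [sq_nonneg τ.re]
  have h3 := lamC_im_of_re_eq_neg_one h2
  rw [h1] at h3
  simpa using h3

/-- The right half of the interior of the fundamental region. -/
def rightRegion : Set ℂ :=
  {τ | 0 < τ.re ∧ τ.re < 1 ∧ 0 < τ.im ∧ τ.re < τ.re ^ 2 + τ.im ^ 2}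

lemma isOpen_rightRegion : IsOpen rightRegion := by
  have hr := Complex.continuous_re
  have hi := Complex.continuous_im
  exact (isOpen_lt continuous_const hr).inter ((isOpen_lt hr continuous_const).inter
    ((isOpen_lt continuous_const hi).inter (isOpen_lt hr ((hr.pow 2).add (hi.pow 2)))))

/-- This says Im(-1/τ) ≥ Y₀ for τ = x + ic on the low edge of the truncated region near the cusp 0.
Lying outside the circle with x ≤ 1/2 forces x ≤ 2c² ≤ c, hence x² + c² ≤ 2c². Near the cusp 1 it is
applied to 1 - x. -/
lemma cusp_bound {x c Y₀ Y : ℝ} (hx0 : 0 ≤ x) (hx : x ≤ 1 / 2) (h : x ≤ x ^ 2 + c ^ 2)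
    (hc0 : 0 < c) (hcY : c * (2 * Y) ≤ 1) (hY : Y₀ ≤ Y) (hY1 : 1 ≤ Y₀) :
    Y₀ * (x ^ 2 + c ^ 2) ≤ c := by
  have hYp : 0 < Y := by linarith
  have hc2 : c ≤ 1 / 2 := by
    have := mul_le_mul_of_nonneg_left (hY1.trans hY) hc0.le
    linarith
  have hx2 : x ≤ 2 * c ^ 2 := by
    have := mul_nonneg hx0 (sub_nonneg.2 hx)
    linarith
  have hx3 : x ≤ c := by
    have := mul_nonneg hc0.le (sub_nonneg.2 hc2)
    linarith
  have hx4 : x ^ 2 + c ^ 2 ≤ 2 * c ^ 2 := by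
    have := pow_le_pow_left₀ hx0 hx3 2
    linarith
  calc Y₀ * (x ^ 2 + c ^ 2) ≤ Y * (2 * c ^ 2) := mul_le_mul hY hx4 (by positivity) hYp.le
    _ = c * (c * (2 * Y)) := by ring
    _ ≤ c * 1 := mul_le_mul_of_nonneg_left hcY hc0.le
    _ = c := mul_one c

/-- Maximum principle for |exp(iλ)| = exp(-Im λ) on the region truncated at heights c and Y. On the
vertical sides and the circle λ is real; the top edge is covered by the expansion at i∞, the bottom
edge by the expansions at the cusps 0 and 1. -/
lemma lamC_im_nonneg {τ : ℂ} (hτ : τ ∈ rightRegion) : 0 ≤ (lamC τ).im := by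
  obtain ⟨Y₀, hY1, hY⟩ := exists_lamC_im_nonneg_of_le_im
  obtain ⟨h0, h1, h2, h3⟩ := hτ
  set Y := max Y₀ (τ.im + 1) with hYdef
  have hY1' : Y₀ ≤ Y := le_max_left _ _
  have hYτ : τ.im < Y := lt_of_lt_of_le (by linarith) (le_max_right _ _)
  -- The first bound is what `cusp_bound` requires; the second keeps τ inside the truncated region.
  set c := min (1 / (2 * Y)) (τ.im / 2) with hc
  have hYpos : 0 < Y := by linarith
  have hc0 : 0 < c := lt_min (by positivity) (by positivity)
  have hcτ : c < τ.im := lt_of_le_of_lt (min_le_right _ _) (by linarith)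
  have hcY : c * (2 * Y) ≤ 1 := by
    have : c ≤ 1 / (2 * Y) := min_le_left _ _
    rwa [le_div_iff₀ (by positivity)] at this
  set U : Set ℂ := {z | 0 < z.re ∧ z.re < 1 ∧ z.re < z.re ^ 2 + z.im ^ 2 ∧ c < z.im ∧ z.im < Y}
  set K : Set ℂ := {z | 0 ≤ z.re ∧ z.re ≤ 1 ∧ z.re ≤ z.re ^ 2 + z.im ^ 2 ∧ c ≤ z.im ∧ z.im ≤ Y}
  have hr := Complex.continuous_re
  have hi := Complex.continuous_im
  have hUo : IsOpen U := (isOpen_lt continuous_const hr).inter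
    ((isOpen_lt hr continuous_const).inter ((isOpen_lt hr ((hr.pow 2).add (hi.pow 2))).inter ((isOpen_lt continuous_const hi).inter
      (isOpen_lt hi continuous_const))))
  have hKc : IsClosed K := (isClosed_le continuous_const hr).inter
    ((isClosed_le hr continuous_const).inter ((isClosed_le hr ((hr.pow 2).add (hi.pow 2))).inter
      ((isClosed_le continuous_const hi).inter (isClosed_le hi continuous_const))))
  have hUK : closure U ⊆ K := closure_minimal
    (fun z hz => ⟨hz.1.le, hz.2.1.le, hz.2.2.1.le, hz.2.2.2.1.le, hz.2.2.2.2.le⟩) hKc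
  have hKb : Bornology.IsBounded K := by
    refine (Metric.isBounded_closedBall (x := (0 : ℂ)) (r := 1 + Y)).subset fun z hz => ?_
    rw [mem_closedBall_zero_iff]
    refine (Complex.norm_le_abs_re_add_abs_im z).trans ?_
    rw [abs_of_nonneg hz.1, abs_of_nonneg (hc0.le.trans hz.2.2.2.1)]
    exact add_le_add hz.2.1 hz.2.2.2.2
  have hKim : ∀ z ∈ K, 0 < z.im := fun z hz => lt_of_lt_of_le hc0 hz.2.2.2.1
  have hfront : ∀ z ∈ frontier U, 0 ≤ (lamC z).im := by
    intro z hz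
    rw [frontier, hUo.interior_eq] at hz
    have hzK := hUK hz.1
    have hzi := hKim z hzK
    obtain ⟨k0, k1, k2, k3, k4⟩ := hzK
    rcases k0.eq_or_lt with e | k0'
    · exact (lamC_im_of_re_eq_zero e.symm).ge
    rcases k1.eq_or_lt with e | k1'
    · exact (lamC_im_of_re_eq_one e).ge
    rcases k2.eq_or_lt with e | k2'
    · exact (lamC_im_of_norm_sub_half_eq hzi e).ge
    rcases k4.eq_or_lt with e | k4'
    · exact hY z k0 k1 (by rw [e]; exact hY1')
    rcases k3.eq_or_lt with e | k3'
    -- On the bottom edge, use the nearer of the cusps 0 and 1.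
    · rcases le_total z.re (1 / 2) with hx | hx
      · apply lamC_im_nonneg_of_one_sub_inv hzi
        have hp : 0 < z.re ^ 2 + z.im ^ 2 := by positivity
        have hq : z.re / (z.re ^ 2 + z.im ^ 2) ≤ 1 := (div_le_one hp).2 k2
        have hq' : 0 ≤ z.re / (z.re ^ 2 + z.im ^ 2) := by positivity
        apply hY
        · rw [Complex.add_re, neg_inv_re, Complex.one_re]; linarith
        · rw [Complex.add_re, neg_inv_re, Complex.one_re]; linarith
        · rw [Complex.add_im, neg_inv_im, Complex.one_im, add_zero, le_div_iff₀ hp, ← e]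
          rw [← e] at k2
          exact cusp_bound k0 hx k2 hc0 hcY hY1' hY1
      · apply lamC_im_nonneg_of_neg_inv_sub_one hzi
        have er : (z - 1).re = z.re - 1 := by simp
        have ei : (z - 1).im = z.im := by simp
        have hp : 0 < (z.re - 1) ^ 2 + z.im ^ 2 := by positivity
        apply hY
        · rw [neg_inv_re, er, ei, ← neg_div]
          exact div_nonneg (by linarith) hp.le
        · rw [neg_inv_re, er, ei, ← neg_div, div_le_one hp]
          linarith
        · rw [neg_inv_im, er, ei, le_div_iff₀ hp, ← e]
          rw [← e] at k2
          rw [show (z.re - 1) ^ 2 = (1 - z.re) ^ 2 by ring]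
          exact cusp_bound (by linarith) (by linarith) (by linarith) hc0 hcY hY1' hY1
    · exact absurd ⟨k0', k1', k2', k3', k4'⟩ hz.2
  have hnorm : ∀ z, ‖Complex.exp (Complex.I * lamC z)‖ ≤ 1 ↔ 0 ≤ (lamC z).im := by
    intro z
    rw [Complex.norm_exp, Real.exp_le_one_iff]
    simp
  have hd : DiffContOnCl ℂ (fun z => Complex.exp (Complex.I * lamC z)) U := by
    apply DifferentiableOn.diffContOnCl
    intro z hz
    exact ((differentiableAt_lamC (hKim z (hUK hz))).const_mul _).cexp.differentiableWithinAt
  rw [← hnorm]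
  exact Complex.norm_le_of_forall_mem_frontier_norm_le (hKb.subset (subset_closure.trans hUK)) hd
    (fun z hz => (hnorm z).2 (hfront z hz)) (subset_closure ⟨h0, h1, h3, hcτ, hYτ⟩)

/-! ### Openness of λ and strict positivity -/

/-- A locally constant λ would be constant, but λ tends to 0 at i∞ without ever vanishing. -/
lemma not_eventually_lamC_eq {τ : ℂ} (hτ : 0 < τ.im) : ¬∀ᶠ z in 𝓝 τ, lamC z = lamC τ := by
  intro h
  have hconv : IsPreconnected {τ : ℂ | 0 < τ.im} := (convex_halfSpace_im_gt 0).isPreconnected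
  have h1 := analyticOnNhd_lamC.eqOn_of_preconnected_of_eventuallyEq
    (analyticOnNhd_const (v := lamC τ)) hconv hτ h
  have h2 : Tendsto lamC (comap Complex.im atTop) (𝓝 (lamC τ)) := by
    refine tendsto_const_nhds.congr' ?_
    filter_upwards [tendsto_comap.eventually (eventually_gt_atTop 0)] with z hz
    exact (h1 hz).symm
  have : (comap Complex.im atTop).NeBot := (tendsto_two_pow_mul hτ).neBot
  exact lamC_ne_zero hτ (tendsto_nhds_unique h2 tendsto_lamC)

lemma map_lamC_nhds {τ : ℂ} (hτ : 0 < τ.im) : map lamC (𝓝 τ) = 𝓝 (lamC τ) :=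
  le_antisymm (differentiableAt_lamC hτ).continuousAt
    ((analyticOnNhd_lamC τ hτ).eventually_constant_or_nhds_le_map_nhds.resolve_left
      (not_eventually_lamC_eq hτ))

/-- By openness of λ, a real value would make the closed upper half plane a neighbourhood of a
boundary point. -/
lemma lamC_im_pos {τ : ℂ} (hτ : τ ∈ rightRegion) : 0 < (lamC τ).im := by
  refine (lamC_im_nonneg hτ).lt_of_ne fun h => ?_
  have h1 : {w : ℂ | 0 ≤ w.im} ∈ 𝓝 (lamC τ) := by
    rw [← map_lamC_nhds hτ.2.2.1, mem_map]
    filter_upwards [isOpen_rightRegion.mem_nhds hτ] with z hz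
    exact lamC_im_nonneg hz
  have h2 := mem_interior_iff_mem_nhds.2 h1
  rw [Complex.interior_setOfPred_le_im] at h2
  exact absurd h.symm (ne_of_gt h2)

/-! ### The hypergeometric series with parameters `1/2, 1/2, 1` -/

/-- The binomial coefficients `(1/2)ₙ / n!`. -/
noncomputable def halfCoeff (n : ℕ) : ℝ :=
  ∏ i ∈ Finset.range n, (2 * (i : ℝ) + 1) / (2 * i + 2)

lemma halfCoeff_succ (n : ℕ) :
    halfCoeff (n + 1) = halfCoeff n * ((2 * (n : ℝ) + 1) / (2 * n + 2)) :=
  Finset.prod_range_succ _ _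

lemma halfCoeff_nonneg (n : ℕ) : 0 ≤ halfCoeff n := Finset.prod_nonneg fun i _ => by positivity

lemma halfCoeff_le_one (n : ℕ) : halfCoeff n ≤ 1 :=
  Finset.prod_le_one (fun i _ => by positivity) fun i _ => by
    rw [div_le_one (by positivity)]; linarith

lemma ringChoose_succ (a : ℂ) (n : ℕ) :
    Ring.choose a (n + 1) = Ring.choose a n * ((a - n) / (n + 1)) := by
  rw [Ring.choose_eq_smul, Ring.choose_eq_smul, descPochhammer_succ_right, Polynomial.smeval_mul,
    Nat.factorial_succ]
  have h : (n.factorial : ℂ) ≠ 0 := Nat.cast_ne_zero.2 n.factorial_ne_zero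
  have h' : (n : ℂ) + 1 ≠ 0 := Nat.cast_add_one_ne_zero n
  simp only [Polynomial.smeval_sub, Polynomial.smeval_X, Polynomial.smeval_natCast, smul_eq_mul]
  push_cast
  field_simp
  simp

lemma ringChoose_neg_half (n : ℕ) :
    Ring.choose (-(1 / 2) : ℂ) n = (-1) ^ n * (halfCoeff n : ℂ) := by
  induction n with
  | zero => simp [halfCoeff]
  | succ n ih =>
    have h' : (n : ℂ) + 1 ≠ 0 := Nat.cast_add_one_ne_zero n
    have h2 : 2 * (n : ℂ) + 2 ≠ 0 := by rw [← mul_add_one]; exact mul_ne_zero two_ne_zero h'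
    rw [ringChoose_succ, ih, halfCoeff_succ]
    push_cast
    field_simp
    ring

lemma hasSum_one_sub_cpow {w : ℂ} (hw : ‖w‖ < 1) :
    HasSum (fun n : ℕ => (halfCoeff n : ℂ) * w ^ n) ((1 - w) ^ (-(1 / 2) : ℂ)) := by
  have h := (Complex.one_add_cpow_hasFPowerSeriesOnBall_zero (a := -(1 / 2))).hasSum (y := -w)
    (by rw [← ENNReal.ofReal_one, Metric.eball_ofReal]; simpa using hw)
  rw [zero_add, ← sub_eq_add_neg] at h
  refine h.congr_fun fun n => ?_
  rw [binomialSeries_apply, List.ofFn_const, List.prod_replicate, ringChoose_neg_half, smul_eq_mul,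
    neg_pow w]
  have : ((-1 : ℂ) ^ n) * (-1) ^ n = 1 := by rw [← mul_pow]; simp
  linear_combination -(halfCoeff n : ℂ) * w ^ n * this

lemma ascPochhammer_half (n : ℕ) :
    (ascPochhammer ℂ n).eval (1 / 2) = halfCoeff n * n.factorial := by
  induction n with
  | zero => simp [halfCoeff]
  | succ n ih =>
    have h' : (n : ℂ) + 1 ≠ 0 := Nat.cast_add_one_ne_zero n
    have h2 : 2 * (n : ℂ) + 2 ≠ 0 := by rw [← mul_add_one]; exact mul_ne_zero two_ne_zero h'
    rw [ascPochhammer_succ_eval, ih, halfCoeff_succ, Nat.factorial_succ]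
    push_cast
    field_simp
    ring

lemma ordinaryHypergeometric_half (z : ℂ) :
    ordinaryHypergeometric (1 / 2 : ℂ) (1 / 2 : ℂ) (1 : ℂ) z
      = ∑' n : ℕ, (halfCoeff n : ℂ) ^ 2 * z ^ n := by
  rw [ordinaryHypergeometric_eq_tsum]
  refine tsum_congr fun n => ?_
  have h : (n.factorial : ℂ) ≠ 0 := Nat.cast_ne_zero.2 n.factorial_ne_zero
  rw [ascPochhammer_half, ascPochhammer_eval_one, smul_eq_mul]
  field_simp

/-- Euler's integral `(1/π) ∫₀^π (1 - z sin² t) ^ (-1/2) dt`. -/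
noncomputable def eulerInt (z : ℂ) : ℂ :=
  (1 / Real.pi) * ∫ t in (0 : ℝ)..Real.pi, (1 - z * (Real.sin t : ℂ) ^ 2) ^ (-(1 / 2) : ℂ)

/-- If zs is real and at least 1 with 0 ≤ s ≤ 1, then z itself lies on the cut. Off the cut the
principal power in Euler's integrand is therefore holomorphic. -/
lemma one_sub_mul_mem_slitPlane {z : ℂ} (hz : z ∈ cutᶜ) {s : ℝ} (h0 : 0 ≤ s) (h1 : s ≤ 1) :
    1 - z * s ∈ Complex.slitPlane := by
  rw [Complex.mem_slitPlane_iff]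
  by_contra! h
  obtain ⟨h2, h3⟩ := h
  simp at h2 h3
  apply hz
  rcases h3 with h3 | h3
  · refine ⟨h3, ?_⟩
    by_contra! h4
    have h5 : z.re * s < 1 := by
      rcases le_total z.re 0 with h6 | h6
      · exact (mul_nonpos_of_nonpos_of_nonneg h6 h0).trans_lt one_pos
      · exact (mul_le_of_le_one_right h6 h1).trans_lt h4
    linarith
  · rw [h3] at h2
    norm_num at h2

lemma one_sub_mul_sin_mem_slitPlane {z : ℂ} (hz : z ∈ cutᶜ) (t : ℝ) :
    1 - z * (Real.sin t : ℂ) ^ 2 ∈ Complex.slitPlane := by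
  have := one_sub_mul_mem_slitPlane hz (sq_nonneg (Real.sin t)) (Real.sin_sq_le_one t)
  simpa using this

lemma isOpen_compl_cut : IsOpen cutᶜ := by
  rw [isOpen_compl_iff]
  exact (isClosed_eq Complex.continuous_im continuous_const).inter
    (isClosed_le continuous_const Complex.continuous_re)

lemma continuous_euler_integrand {z : ℂ} (hz : z ∈ cutᶜ) (a : ℂ) :
    Continuous fun t : ℝ => (1 - z * (Real.sin t : ℂ) ^ 2) ^ a := by
  refine Continuous.cpow (by fun_prop) continuous_const fun t => one_sub_mul_sin_mem_slitPlane hz t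

lemma differentiableOn_eulerInt : DifferentiableOn ℂ eulerInt cutᶜ := by
  intro z₀ hz₀
  obtain ⟨r, hr, hball⟩ := Metric.isOpen_iff.1 isOpen_compl_cut z₀ hz₀
  set K : Set ℂ := Metric.closedBall z₀ (r / 2)
  have hK : K ⊆ cutᶜ := (Metric.closedBall_subset_ball (by linarith)).trans hball
  set F' : ℂ → ℝ → ℂ := fun z t => -(1 / 2) * (1 - z * (Real.sin t : ℂ) ^ 2) ^ (-(1 / 2) - 1 : ℂ) *
    (-(Real.sin t : ℂ) ^ 2)
  have hcont : ContinuousOn (fun p : ℂ × ℝ => F' p.1 p.2) (K ×ˢ Icc 0 Real.pi) := by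
    refine ContinuousOn.mul (ContinuousOn.mul continuousOn_const ?_) (by fun_prop)
    refine ContinuousOn.cpow (by fun_prop) continuousOn_const fun p hp => ?_
    exact one_sub_mul_sin_mem_slitPlane (hK hp.1) _
  obtain ⟨C, hC⟩ :=
    ((isCompact_closedBall z₀ (r / 2)).prod isCompact_Icc).exists_bound_of_continuousOn hcont
  have h := intervalIntegral.hasDerivAt_integral_of_dominated_loc_of_deriv_le
    (μ := MeasureTheory.volume) (a := 0) (b := Real.pi) (x₀ := z₀) (bound := fun _ => C)
    (F := fun z t => (1 - z * (Real.sin t : ℂ) ^ 2) ^ (-(1 / 2) : ℂ)) (F' := F')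
    (Metric.ball_mem_nhds z₀ (half_pos hr)) ?_ ?_ ?_ ?_ ?_ ?_
  · exact (h.2.differentiableAt.const_mul _).differentiableWithinAt
  · filter_upwards [isOpen_compl_cut.mem_nhds hz₀] with z hz
    exact (continuous_euler_integrand hz _).aestronglyMeasurable
  · exact (continuous_euler_integrand hz₀ _).intervalIntegrable _ _
  · refine Continuous.aestronglyMeasurable ?_
    exact (continuous_const.mul (continuous_euler_integrand hz₀ _)).mul (by fun_prop)
  · refine Eventually.of_forall fun t ht z hz => hC (z, t) ⟨Metric.ball_subset_closedBall hz, ?_⟩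
    rw [uIoc_of_le Real.pi_pos.le] at ht
    exact Ioc_subset_Icc_self ht
  · exact intervalIntegrable_const
  · refine Eventually.of_forall fun t _ z hz => ?_
    have h1 : HasDerivAt (fun z : ℂ => 1 - z * (Real.sin t : ℂ) ^ 2)
        (-(Real.sin t : ℂ) ^ 2) z := by
      simpa using ((hasDerivAt_id z).mul_const ((Real.sin t : ℂ) ^ 2)).const_sub 1
    exact h1.cpow_const (one_sub_mul_sin_mem_slitPlane
      (hK (Metric.ball_subset_closedBall hz)) t)

/-- The binomial series gives one factor `halfCoeff n`; integrating termwise, the Wallis integral of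
sin²ⁿ gives the other. -/
lemma hasSum_eulerInt {z : ℂ} (hz : ‖z‖ < 1) :
    HasSum (fun n : ℕ => (halfCoeff n : ℂ) ^ 2 * z ^ n) (eulerInt z) := by
  have h := intervalIntegral.hasSum_integral_of_dominated_convergence
    (μ := MeasureTheory.volume) (a := 0) (b := Real.pi)
    (F := fun (n : ℕ) (t : ℝ) => (halfCoeff n : ℂ) * (z * (Real.sin t : ℂ) ^ 2) ^ n)
    (f := fun t : ℝ => (1 - z * (Real.sin t : ℂ) ^ 2) ^ (-(1 / 2) : ℂ))
    (fun n _ => ‖z‖ ^ n) ?_ ?_ ?_ ?_ ?_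
  · have hπ : (Real.pi : ℂ) ≠ 0 := by exact_mod_cast Real.pi_ne_zero
    refine (h.mul_left (1 / (Real.pi : ℂ))).congr_fun fun n => ?_
    simp only [mul_pow, ← pow_mul]
    rw [intervalIntegral.integral_const_mul, intervalIntegral.integral_const_mul]
    have h1 : (∫ t in (0 : ℝ)..Real.pi, (Real.sin t : ℂ) ^ (2 * n))
        = ((Real.pi * halfCoeff n : ℝ) : ℂ) := by
      rw [halfCoeff, ← integral_sin_pow_even, ← intervalIntegral.integral_ofReal]
      push_cast
      rfl
    rw [h1]
    push_cast
    field_simp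
  · intro n
    exact (by fun_prop : Continuous fun t : ℝ =>
      (halfCoeff n : ℂ) * (z * (Real.sin t : ℂ) ^ 2) ^ n).aestronglyMeasurable
  · refine fun n => Eventually.of_forall fun t _ => ?_
    rw [norm_mul, norm_pow, norm_mul, Complex.norm_real, Real.norm_of_nonneg (halfCoeff_nonneg n),
      norm_pow, Complex.norm_real, Real.norm_eq_abs, sq_abs]
    have h1 : ‖z‖ * Real.sin t ^ 2 ≤ ‖z‖ := mul_le_of_le_one_right (norm_nonneg _)
      (Real.sin_sq_le_one t)
    have h2 := pow_le_pow_left₀ (by positivity) h1 n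
    exact (mul_le_of_le_one_left (by positivity) (halfCoeff_le_one n)).trans h2
  · exact Eventually.of_forall fun t _ => summable_geometric_of_lt_one (norm_nonneg _) hz
  · exact intervalIntegrable_const
  · refine Eventually.of_forall fun t _ => hasSum_one_sub_cpow ?_
    rw [norm_mul, norm_pow, Complex.norm_real, Real.norm_eq_abs, sq_abs]
    exact lt_of_le_of_lt (mul_le_of_le_one_right (norm_nonneg _) (Real.sin_sq_le_one t)) hz

lemma eulerInt_eq {z : ℂ} (hz : ‖z‖ < 1) :
    eulerInt z = ordinaryHypergeometric (1 / 2 : ℂ) (1 / 2 : ℂ) (1 : ℂ) z := by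
  rw [ordinaryHypergeometric_half, (hasSum_eulerInt hz).tsum_eq]

/-! ### Landen's transformation -/

lemma integral_exp_two_mul_I (k : ℤ) :
    (∫ t in (0 : ℝ)..Real.pi, Complex.exp (2 * k * Complex.I * t))
      = if k = 0 then ↑Real.pi else 0 := by
  split_ifs with h
  · simp [h]
  · have hk : (2 * (k : ℂ) * Complex.I) ≠ 0 := by simp [h]
    rw [integral_exp_mul_complex hk]
    have : Complex.exp (2 * (k : ℂ) * Complex.I * Real.pi) = 1 :=
      Complex.exp_eq_one_iff.2 ⟨k, by ring⟩
    rw [this]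
    simp

/-- `(1 + x exp(2it)) ^ (-1/2)`. -/
noncomputable def landenAux (x t : ℝ) : ℂ :=
  (1 - -x * Complex.exp (2 * Complex.I * t)) ^ (-(1 / 2) : ℂ)

lemma norm_neg_mul_exp {x : ℝ} (hx0 : 0 ≤ x) (t : ℝ) :
    ‖-(x : ℂ) * Complex.exp (2 * Complex.I * t)‖ = x := by
  rw [norm_mul, norm_neg, Complex.norm_real, Real.norm_of_nonneg hx0, Complex.norm_exp]
  simp

lemma hasSum_landenAux {x : ℝ} (hx0 : 0 ≤ x) (hx1 : x < 1) (t : ℝ) :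
    HasSum (fun n : ℕ => (halfCoeff n : ℂ) * ((-x : ℂ) * Complex.exp (2 * Complex.I * t)) ^ n)
      (landenAux x t) :=
  hasSum_one_sub_cpow (by rw [norm_neg_mul_exp hx0]; exact hx1)

lemma norm_landenAux_term {x : ℝ} (hx0 : 0 ≤ x) (t : ℝ) (n : ℕ) :
    ‖(halfCoeff n : ℂ) * ((-x : ℂ) * Complex.exp (2 * Complex.I * t)) ^ n‖ ≤ x ^ n := by
  rw [norm_mul, norm_pow, norm_neg_mul_exp hx0, Complex.norm_real,
    Real.norm_of_nonneg (halfCoeff_nonneg n)]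
  exact mul_le_of_le_one_left (by positivity) (halfCoeff_le_one n)

lemma norm_landenAux_le {x : ℝ} (hx0 : 0 ≤ x) (hx1 : x < 1) (t : ℝ) :
    ‖landenAux x t‖ ≤ (1 - x)⁻¹ := by
  rw [← (hasSum_landenAux hx0 hx1 t).tsum_eq]
  exact tsum_of_norm_bounded (hasSum_geometric_of_lt_one hx0 hx1) (norm_landenAux_term hx0 t)

lemma continuous_landenAux {x : ℝ} (hx0 : 0 ≤ x) (hx1 : x < 1) : Continuous (landenAux x) := by
  refine Continuous.cpow (by fun_prop) continuous_const fun t => ?_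
  rw [sub_eq_add_neg]
  exact Complex.mem_slitPlane_of_norm_lt_one (by rw [norm_neg, norm_neg_mul_exp hx0]; exact hx1)

/-- Orthogonality of the exponentials on [0, π] extracts one Fourier coefficient. -/
lemma integral_exp_mul_conj_landenAux {x : ℝ} (hx0 : 0 ≤ x) (hx1 : x < 1) (n : ℕ) :
    (∫ t in (0 : ℝ)..Real.pi, Complex.exp (2 * Complex.I * t) ^ n * conj (landenAux x t))
      = Real.pi * (halfCoeff n * (-x) ^ n) := by
  have h := intervalIntegral.hasSum_integral_of_dominated_convergence
    (μ := MeasureTheory.volume) (a := 0) (b := Real.pi)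
    (F := fun (m : ℕ) (t : ℝ) => Complex.exp (2 * Complex.I * t) ^ n *
      conj ((halfCoeff m : ℂ) * ((-x : ℂ) * Complex.exp (2 * Complex.I * t)) ^ m))
    (f := fun t : ℝ => Complex.exp (2 * Complex.I * t) ^ n * conj (landenAux x t))
    (fun n _ => x ^ n) ?_ ?_ ?_ ?_ ?_
  · have key : ∀ m : ℕ, (∫ t in (0 : ℝ)..Real.pi, Complex.exp (2 * Complex.I * t) ^ n *
        conj ((halfCoeff m : ℂ) * ((-x : ℂ) * Complex.exp (2 * Complex.I * t)) ^ m))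
        = if m = n then Real.pi * ((halfCoeff n : ℂ) * (-x) ^ n) else 0 := by
      intro m
      have e : ∀ t : ℝ, Complex.exp (2 * Complex.I * t) ^ n *
          conj ((halfCoeff m : ℂ) * ((-x : ℂ) * Complex.exp (2 * Complex.I * t)) ^ m)
          = (halfCoeff m : ℂ) * (-x) ^ m *
            Complex.exp (2 * ((n - m : ℤ) : ℂ) * Complex.I * t) := by
        intro t
        rw [map_mul, map_pow, map_mul, ← Complex.exp_conj, mul_pow, ← Complex.exp_nat_mul,
          ← Complex.exp_nat_mul]
        simp only [map_neg, Complex.conj_ofReal, map_mul, Complex.conj_I, Complex.conj_ofNat]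
        rw [show ((n - m : ℤ) : ℂ) = (n : ℂ) - m by push_cast; ring,
          show 2 * ((n : ℂ) - m) * Complex.I * t
            = n * (2 * Complex.I * t) + m * (2 * -Complex.I * t) by ring, Complex.exp_add]
        ring
      simp_rw [e]
      rw [intervalIntegral.integral_const_mul, integral_exp_two_mul_I]
      by_cases hmn : m = n
      · rw [if_pos hmn, if_pos (by omega), hmn]
        ring
      · rw [if_neg hmn, if_neg (by omega), mul_zero]
    simp_rw [key] at h
    exact h.unique (hasSum_ite_eq n _)
  · intro m
    refine Continuous.aestronglyMeasurable ?_
    exact (by fun_prop : Continuous fun t : ℝ => Complex.exp (2 * Complex.I * t) ^ n).mul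
      (Complex.continuous_conj.comp (by fun_prop))
  · refine fun m => Eventually.of_forall fun t _ => ?_
    rw [norm_mul, RCLike.norm_conj, norm_pow, Complex.norm_exp]
    simpa using norm_landenAux_term hx0 t m
  · exact Eventually.of_forall fun t _ => summable_geometric_of_lt_one hx0 hx1
  · exact intervalIntegrable_const
  · refine Eventually.of_forall fun t _ => HasSum.mul_left _ ?_
    exact Complex.hasSum_conj'.2 (by simpa using hasSum_landenAux hx0 hx1 t)

/-- Parseval: the squared Fourier coefficients `halfCoeff n ^ 2 * x ^ (2 * n)` are the terms of the
hypergeometric series at x². -/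
lemma integral_landenAux {x : ℝ} (hx0 : 0 ≤ x) (hx1 : x < 1) :
    (∫ t in (0 : ℝ)..Real.pi, landenAux x t * conj (landenAux x t))
      = Real.pi * eulerInt ((x : ℂ) ^ 2) := by
  have h := intervalIntegral.hasSum_integral_of_dominated_convergence
    (μ := MeasureTheory.volume) (a := 0) (b := Real.pi)
    (F := fun (m : ℕ) (t : ℝ) => ((halfCoeff m : ℂ) *
      ((-x : ℂ) * Complex.exp (2 * Complex.I * t)) ^ m) * conj (landenAux x t))
    (f := fun t : ℝ => landenAux x t * conj (landenAux x t))
    (fun n _ => x ^ n * (1 - x)⁻¹) ?_ ?_ ?_ ?_ ?_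
  · have key : ∀ m : ℕ, (∫ t in (0 : ℝ)..Real.pi, ((halfCoeff m : ℂ) *
        ((-x : ℂ) * Complex.exp (2 * Complex.I * t)) ^ m) * conj (landenAux x t))
        = Real.pi * ((halfCoeff m : ℂ) ^ 2 * ((x : ℂ) ^ 2) ^ m) := by
      intro m
      simp_rw [mul_pow, mul_assoc (halfCoeff m : ℂ), mul_assoc ((-x : ℂ) ^ m)]
      rw [intervalIntegral.integral_const_mul, intervalIntegral.integral_const_mul,
        integral_exp_mul_conj_landenAux hx0 hx1]
      have : ((-x : ℂ) ^ m) * (-x) ^ m = (x ^ 2) ^ m := by rw [← mul_pow]; ring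
      linear_combination Real.pi * (halfCoeff m : ℂ) ^ 2 * this
    simp_rw [key] at h
    refine h.unique ((hasSum_eulerInt ?_).mul_left _)
    rw [norm_pow, Complex.norm_real, Real.norm_of_nonneg hx0]
    exact pow_lt_one₀ hx0 hx1 two_ne_zero
  · intro m
    refine Continuous.aestronglyMeasurable ?_
    exact (by fun_prop : Continuous fun t : ℝ => (halfCoeff m : ℂ) *
      ((-x : ℂ) * Complex.exp (2 * Complex.I * t)) ^ m).mul
      (Complex.continuous_conj.comp (continuous_landenAux hx0 hx1))
  · refine fun m => Eventually.of_forall fun t _ => ?_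
    rw [norm_mul, RCLike.norm_conj]
    exact mul_le_mul (norm_landenAux_term hx0 t m) (norm_landenAux_le hx0 hx1 t) (norm_nonneg _)
      (by positivity)
  · exact Eventually.of_forall fun t _ => (summable_geometric_of_lt_one hx0 hx1).mul_right _
  · exact intervalIntegrable_const
  · exact Eventually.of_forall fun t _ => (hasSum_landenAux hx0 hx1 t).mul_right _

lemma normSq_one_add_exp (x t : ℝ) :
    ‖1 - -(x : ℂ) * Complex.exp (2 * Complex.I * t)‖ ^ 2
      = (1 + x) ^ 2 - 4 * x * Real.sin t ^ 2 := by
  rw [show (2 * Complex.I * t : ℂ) = ((2 * t : ℝ) : ℂ) * Complex.I by push_cast; ring,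
    Complex.exp_mul_I, ← Complex.ofReal_cos, ← Complex.ofReal_sin, Complex.sq_norm,
    Complex.normSq_apply, Real.cos_two_mul, Real.sin_two_mul]
  simp only [neg_mul, sub_neg_eq_add, Complex.add_re, Complex.one_re, Complex.mul_re,
    Complex.ofReal_re, Complex.ofReal_im, Complex.I_re, Complex.I_im, Complex.add_im,
    Complex.one_im, Complex.mul_im, mul_zero, zero_mul, mul_one, sub_zero, add_zero, zero_add]
  have := Real.sin_sq_add_cos_sq t
  have h : Real.cos t ^ 2 = 1 - Real.sin t ^ 2 := by linarith
  ring_nf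
  rw [show Real.cos t ^ 4 = (Real.cos t ^ 2) ^ 2 by ring, h]
  ring

/-- Landen's transformation `F(4x/(1+x)²) = (1 + x) F(x²)`. -/
lemma eulerInt_landen {x : ℝ} (hx0 : 0 ≤ x) (hx1 : x < 1) :
    eulerInt (4 * x / (1 + x) ^ 2) = (1 + x) * eulerInt ((x : ℂ) ^ 2) := by
  have hπ : (Real.pi : ℂ) ≠ 0 := by exact_mod_cast Real.pi_ne_zero
  -- With w = 1 + x exp(2it), the base on the left is (|w|/(1+x))², so its power -1/2 is (1+x)/|w| =
  -- (1+x)|w^(-1/2)|².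
  have e : ∀ t : ℝ, (1 - (4 * x / (1 + x) ^ 2 : ℂ) * (Real.sin t : ℂ) ^ 2) ^ (-(1 / 2) : ℂ)
      = (1 + x) * (landenAux x t * conj (landenAux x t)) := by
    intro t
    set w : ℂ := 1 - -(x : ℂ) * Complex.exp (2 * Complex.I * t) with hw
    have hw2 := normSq_one_add_exp x t
    rw [← hw] at hw2
    have hw0 : w ≠ 0 := by
      intro h0
      have : ‖-(x : ℂ) * Complex.exp (2 * Complex.I * t)‖ = 1 := by
        rw [← sub_eq_zero.1 h0, norm_one]
      rw [norm_neg_mul_exp hx0] at this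
      linarith
    have hn : 0 < ‖w‖ := norm_pos_iff.2 hw0
    have hx : 0 < 1 + x := by linarith
    have h1 : (1 - (4 * x / (1 + x) ^ 2 : ℂ) * (Real.sin t : ℂ) ^ 2)
        = (((‖w‖ / (1 + x)) ^ 2 : ℝ) : ℂ) := by
      rw [div_pow, hw2]
      have : (1 + x : ℂ) ≠ 0 := by exact_mod_cast hx.ne'
      push_cast
      field_simp
    have h2 : landenAux x t * conj (landenAux x t) = ((‖w‖⁻¹ : ℝ) : ℂ) := by
      rw [Complex.mul_conj, Complex.normSq_eq_norm_sq, landenAux, ← hw]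
      have h3 : ‖w ^ (-(1 / 2) : ℂ)‖ = ‖w‖ ^ (-(1 / 2) : ℝ) := by
        have := Complex.norm_cpow_of_ne_zero hw0 (-(1 / 2))
        rw [this]
        simp
      rw [h3, ← Real.rpow_natCast, ← Real.rpow_mul hn.le]
      norm_num
      simp [Real.rpow_neg_one]
    rw [h1, h2, show (-(1 / 2) : ℂ) = ((-(1 / 2) : ℝ) : ℂ) by push_cast; rfl,
      ← Complex.ofReal_cpow (by positivity), ← Real.rpow_natCast, ← Real.rpow_mul (by positivity)]
    have : ((2 : ℕ) : ℝ) * (-(1 / 2)) = -1 := by norm_num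
    rw [this, Real.rpow_neg_one, inv_div]
    push_cast
    rw [div_eq_mul_inv]
  rw [eulerInt]
  simp_rw [e]
  rw [intervalIntegral.integral_const_mul, integral_landenAux hx0 hx1]
  field_simp

/-! ### Jacobi's formula on the imaginary axis -/

lemma exists_real_ratio {τ : ℂ} (hτ : 0 < τ.im) (h : τ.re = 0) :
    ∃ x : ℝ, 0 ≤ x ∧ x < 1 ∧ th10 τ ^ 2 = x * th00 τ ^ 2 ∧ lamC τ = (x : ℂ) ^ 2 := by
  have hc := neg_conj_of_re_eq_zero h
  obtain ⟨a, ha⟩ := exists_ofReal_of_conj_eq (z := th00 τ) (by rw [← th00_neg_conj, hc])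
  obtain ⟨c, hd⟩ := exists_ofReal_of_conj_eq (z := th10 τ) (by rw [← th10_neg_conj, hc])
  obtain ⟨r, hr0, hr1, hr⟩ := lamC_of_re_eq_zero hτ h
  have ha0 : (a : ℂ) ≠ 0 := ha ▸ th00_ne_zero hτ
  have e : lamC τ = ((c ^ 2 / a ^ 2 : ℝ) : ℂ) ^ 2 := by
    rw [lamC, ha, hd]
    push_cast
    rw [div_pow, ← pow_mul, ← pow_mul]
  refine ⟨c ^ 2 / a ^ 2, by positivity, ?_, ?_, e⟩
  · rw [hr] at e
    have e' : r = (c ^ 2 / a ^ 2) ^ 2 := by exact_mod_cast e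
    by_contra! h1
    have := one_le_pow₀ h1 (n := 2)
    linarith
  · rw [ha, hd]
    push_cast
    field_simp

/-- Landen meets duplication: for x = ϑ₁₀(2τ)²/ϑ₀₀(2τ)² one has λ(2τ) = x², λ(τ) = 4x/(1+x)² and
ϑ₀₀(τ)² = (1+x)ϑ₀₀(2τ)². -/
lemma eulerInt_lamC_two_mul {τ : ℂ} (hτ : 0 < τ.im) (h : τ.re = 0) :
    eulerInt (lamC τ) * th00 (2 * τ) ^ 2 = eulerInt (lamC (2 * τ)) * th00 τ ^ 2 := by
  have hτ2 := two_mul_im_pos hτ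
  obtain ⟨x, hx0, hx1, hx, hl⟩ := exists_real_ratio hτ2 (by simp [h])
  have h0 := th00_ne_zero hτ2
  have h1 : th00 τ ^ 2 = (1 + x) * th00 (2 * τ) ^ 2 := by
    rw [th00_sq hτ, hx]; ring
  have hx' : (1 + x : ℂ) ≠ 0 := by
    have : 1 + x ≠ 0 := by linarith
    exact_mod_cast this
  have h2 : lamC τ = 4 * x / (1 + x) ^ 2 := by
    rw [lamC, show th10 τ ^ 4 = (th10 τ ^ 2) ^ 2 by ring,
      show th00 τ ^ 4 = (th00 τ ^ 2) ^ 2 by ring,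
      h1, th10_sq hτ, mul_pow _ (th10 (2 * τ)), hx]
    field_simp
    ring
  rw [h2, eulerInt_landen hx0 hx1, hl, h1]
  ring

lemma mem_compl_cut_of_norm_lt_one {z : ℂ} (hz : ‖z‖ < 1) : z ∈ cutᶜ :=
  fun h => absurd (h.2.trans (Complex.re_le_norm z)) (not_le.2 hz)

lemma eulerInt_zero : eulerInt 0 = 1 := by
  rw [eulerInt_eq (by simp), ordinaryHypergeometric_zero]

/-- The quotient of the two sides is constant along 2ⁿτ and tends to F(0)/1 = 1. -/
lemma eulerInt_lamC_of_re_eq_zero {τ : ℂ} (hτ : 0 < τ.im) (h : τ.re = 0) :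
    eulerInt (lamC τ) = th00 τ ^ 2 := by
  have hre : ∀ n : ℕ, ((2 : ℂ) ^ n * τ).re = 0 := fun n => by
    rw [show ((2 : ℂ) ^ n) = ((2 ^ n : ℝ) : ℂ) by push_cast; rfl, Complex.re_ofReal_mul, h,
      mul_zero]
  have key : ∀ n : ℕ, eulerInt (lamC (2 ^ n * τ)) / th00 (2 ^ n * τ) ^ 2
      = eulerInt (lamC τ) / th00 τ ^ 2 := by
    intro n
    induction n with
    | zero => simp
    | succ n ih =>
      have h1 := eulerInt_lamC_two_mul (two_pow_mul_im_pos hτ n) (hre n)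
      rw [← mul_assoc, ← pow_succ'] at h1
      rw [← ih, div_eq_div_iff (pow_ne_zero _ (th00_ne_zero (two_pow_mul_im_pos hτ _)))
        (pow_ne_zero _ (th00_ne_zero (two_pow_mul_im_pos hτ _))), h1]
  have hc : ContinuousAt eulerInt 0 := (differentiableOn_eulerInt.differentiableAt
    (isOpen_compl_cut.mem_nhds (mem_compl_cut_of_norm_lt_one (by simp)))).continuousAt
  have h1 : Tendsto (fun n : ℕ => eulerInt (lamC (2 ^ n * τ)) / th00 (2 ^ n * τ) ^ 2) atTop
      (𝓝 (eulerInt 0 / 1 ^ 2)) :=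
    (hc.tendsto.comp (tendsto_lamC.comp (tendsto_two_pow_mul hτ))).div
      ((tendsto_th00.comp (tendsto_two_pow_mul hτ)).pow 2) (by simp)
  have h2 := tendsto_nhds_unique (tendsto_const_nhds.congr fun n => (key n).symm) h1
  rw [eulerInt_zero, one_pow, div_one, div_eq_one_iff_eq (pow_ne_zero _ (th00_ne_zero hτ))] at h2
  exact h2

/-! ### Jacobi's formula in the interior of the fundamental region -/

/-- The interior of the fundamental region, as a subset of `ℂ`. -/
def fundInterior : Set ℂ :=
  {τ | -1 < τ.re ∧ τ.re < 1 ∧ 0 < τ.im ∧ τ.re < τ.re ^ 2 + τ.im ^ 2 ∧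
    -τ.re < τ.re ^ 2 + τ.im ^ 2}

lemma isOpen_fundInterior : IsOpen fundInterior := by
  have hr := Complex.continuous_re
  have hi := Complex.continuous_im
  have hn := (hr.pow 2).add (hi.pow 2)
  exact (isOpen_lt continuous_const hr).inter ((isOpen_lt hr continuous_const).inter
    ((isOpen_lt continuous_const hi).inter ((isOpen_lt hr hn).inter (isOpen_lt hr.neg hn))))

lemma rightRegion_subset_fundInterior : rightRegion ⊆ fundInterior := fun τ ⟨h0, h1, h2, h3⟩ =>
  ⟨by linarith, h1, h2, h3, by linarith⟩

lemma neg_conj_mem_rightRegion {τ : ℂ} (h : τ ∈ fundInterior) (h0 : τ.re < 0) :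
    -conj τ ∈ rightRegion := by
  obtain ⟨h1, h2, h3, h4, h5⟩ := h
  refine ⟨?_, ?_, ?_, ?_⟩ <;> simp <;> linarith

lemma lamC_mem_compl_cut {τ : ℂ} (h : τ ∈ fundInterior) : lamC τ ∈ cutᶜ := by
  rintro ⟨h1, h2⟩
  rcases lt_trichotomy τ.re 0 with h0 | h0 | h0
  · have := lamC_im_pos (neg_conj_mem_rightRegion h h0)
    rw [lamC_neg_conj, Complex.conj_im, h1] at this
    simp at this
  · obtain ⟨r, -, hr, e⟩ := lamC_of_re_eq_zero h.2.2.1 h0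
    rw [e, Complex.ofReal_re] at h2
    linarith
  · exact absurd h1 (lamC_im_pos ⟨h0, h.2.1, h.2.2.1, h.2.2.2.1⟩).ne'

/-- The conditions on the function `F(1/2,1/2,1;z)` away from the half line `[1, ∞)`. -/
structure IsHGFOffCut (F : ℂ → ℂ) : Prop where
  differentiableOn : DifferentiableOn ℂ F cutᶜ
  eq_series : ∀ z : ℂ, ‖z‖ < 1 → F z = ordinaryHypergeometric (1 / 2 : ℂ) (1 / 2 : ℂ) (1 : ℂ) z

/-- The arguments below are for an arbitrary F of this kind because they serve twice: for
`eulerInt`, to get the boundary limits that make `hgf` exist, and then for `hgf` itself. -/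
lemma isHGFOffCut_eulerInt : IsHGFOffCut eulerInt :=
  ⟨differentiableOn_eulerInt, fun _ => eulerInt_eq⟩

namespace IsHGFOffCut

variable {F : ℂ → ℂ}

lemma comp_lamC_of_re_eq_zero (hF : IsHGFOffCut F) {τ : ℂ} (hτ : 0 < τ.im) (h : τ.re = 0) :
    F (lamC τ) = th00 τ ^ 2 := by
  rw [← eulerInt_lamC_of_re_eq_zero hτ h]
  obtain ⟨r, hr0, hr1, e⟩ := lamC_of_re_eq_zero hτ h
  have : ‖lamC τ‖ < 1 := by rwa [e, Complex.norm_real, Real.norm_of_nonneg hr0.le]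
  rw [hF.eq_series _ this, eulerInt_eq this]

lemma analyticOnNhd_comp_lamC (hF : IsHGFOffCut F) :
    AnalyticOnNhd ℂ (fun τ => F (lamC τ)) fundInterior := by
  refine DifferentiableOn.analyticOnNhd (fun τ hτ => ?_) isOpen_fundInterior
  exact ((hF.differentiableOn.differentiableAt (isOpen_compl_cut.mem_nhds
    (lamC_mem_compl_cut hτ))).comp τ (differentiableAt_lamC hτ.2.2.1)).differentiableWithinAt

lemma _root_.JacobiExt.analyticOnNhd_th00_sq :
    AnalyticOnNhd ℂ (fun τ => th00 τ ^ 2) {τ : ℂ | 0 < τ.im} :=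
  fun τ h => (analyticOnNhd_th00 τ h).pow 2

/-- The half strip above height 1 is convex and contains a segment of the imaginary axis, so the
identity theorem applies. -/
lemma comp_lamC_of_one_lt_im (hF : IsHGFOffCut F) {τ : ℂ} (h0 : -1 < τ.re) (h1 : τ.re < 1)
    (hτ : 1 < τ.im) : F (lamC τ) = th00 τ ^ 2 := by
  set U : Set ℂ := {z | -1 < z.re ∧ z.re < 1 ∧ 1 < z.im}
  have hU : IsPreconnected U := ((convex_halfSpace_re_gt (-1)).inter
    ((convex_halfSpace_re_lt 1).inter (convex_halfSpace_im_gt 1))).isPreconnected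
  have hUD : U ⊆ fundInterior := by
    rintro z ⟨hz0, hz1, hz2⟩
    have : 1 < z.im ^ 2 := one_lt_pow₀ hz2 two_ne_zero
    have h3 := sq_nonneg z.re
    exact ⟨hz0, hz1, by linarith, by linarith, by linarith⟩
  have h2 : (2 * Complex.I) ∈ U := ⟨by simp, by simp, by simp⟩
  refine (hF.analyticOnNhd_comp_lamC.mono hUD).eqOn_of_preconnected_of_frequently_eq
    (analyticOnNhd_th00_sq.mono fun z hz => (hUD hz).2.2.1) hU h2 ?_ ⟨h0, h1, hτ⟩
  have ht : Tendsto (fun y : ℝ => (y : ℂ) * Complex.I) (𝓝[≠] 2) (𝓝[≠] (2 * Complex.I)) := by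
    refine tendsto_nhdsWithin_iff.2 ⟨?_, ?_⟩
    · have : Continuous fun y : ℝ => (y : ℂ) * Complex.I := by fun_prop
      simpa using (this.tendsto 2).mono_left nhdsWithin_le_nhds
    · filter_upwards [self_mem_nhdsWithin] with y hy h
      apply hy
      have := congrArg Complex.im h
      simpa using this
  refine ht.frequently (Eventually.frequently ?_)
  filter_upwards [nhdsWithin_le_nhds (lt_mem_nhds (show (0 : ℝ) < 2 by norm_num))] with y hy
  exact hF.comp_lamC_of_re_eq_zero (by simpa using hy) (by simp)

/-- The interior contains the vertical ray above each of its points. Continuing down that ray from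
height greater than 1 avoids proving the whole interior connected. -/
lemma comp_lamC (hF : IsHGFOffCut F) {τ : ℂ} (hτ : τ ∈ fundInterior) :
    F (lamC τ) = th00 τ ^ 2 := by
  set U : Set ℂ := {z | z.re = τ.re ∧ τ.im ≤ z.im}
  have hU : IsPreconnected U :=
    ((convex_hyperplane Complex.reLm.isLinear τ.re).inter
      (convex_halfSpace_im_ge τ.im)).isPreconnected
  have hUD : U ⊆ fundInterior := by
    rintro z ⟨hz0, hz1⟩
    obtain ⟨k0, k1, k2, k3, k4⟩ := hτ
    have := pow_le_pow_left₀ k2.le hz1 2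
    refine ⟨?_, ?_, k2.trans_le hz1, ?_, ?_⟩ <;> rw [hz0] <;> linarith
  set z₀ : ℂ := ⟨τ.re, τ.im + 1⟩
  have hz₀ : z₀ ∈ U := ⟨rfl, by simp [z₀]⟩
  refine (hF.analyticOnNhd_comp_lamC.mono hUD).eqOn_of_preconnected_of_eventuallyEq
    (analyticOnNhd_th00_sq.mono fun z hz => (hUD hz).2.2.1) hU hz₀ ?_ ⟨rfl, le_rfl⟩
  have h1 : ∀ᶠ z in 𝓝 z₀, 1 < z.im := (Complex.continuous_im.tendsto z₀).eventually
    (lt_mem_nhds (by simpa [z₀] using hτ.2.2.1))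
  filter_upwards [h1, isOpen_fundInterior.mem_nhds (hUD hz₀)] with z hz hzD
  exact hF.comp_lamC_of_one_lt_im hzD.1 hzD.2.1 hz

/-! ### The vertical boundary -/

lemma _root_.JacobiExt.lamC_of_re_eq_one {τ : ℂ} (hτ : 0 < τ.im) (h : τ.re = 1) :
    ∃ r : ℝ, r < 0 ∧ lamC τ = r := by
  have hs : 0 < (τ - 1).im := by simpa using hτ
  obtain ⟨r, hr0, hr1, e⟩ := lamC_of_re_eq_zero hs (by simp [h])
  refine ⟨r / (r - 1), div_neg_of_pos_of_neg hr0 (by linarith), ?_⟩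
  have h1 := lamC_add_one hs
  rw [sub_add_cancel, e] at h1
  rw [h1]
  push_cast
  rfl

lemma _root_.JacobiExt.lamC_mem_compl_cut_of_re_eq_one {τ : ℂ} (hτ : 0 < τ.im) (h : τ.re = 1) :
    lamC τ ∈ cutᶜ := by
  obtain ⟨r, hr, e⟩ := lamC_of_re_eq_one hτ h
  rintro ⟨-, h2⟩
  rw [e, Complex.ofReal_re] at h2
  linarith

lemma comp_lamC_of_re_eq_one (hF : IsHGFOffCut F) {τ : ℂ} (hτ : 0 < τ.im) (h : τ.re = 1) :
    F (lamC τ) = th00 τ ^ 2 := by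
  have hc1 : ContinuousAt (fun τ => F (lamC τ)) τ :=
    (hF.differentiableOn.differentiableAt (isOpen_compl_cut.mem_nhds
      (lamC_mem_compl_cut_of_re_eq_one hτ h))).continuousAt.comp
      (differentiableAt_lamC hτ).continuousAt
  have hc2 : ContinuousAt (fun τ => th00 τ ^ 2) τ := (differentiableAt_th00 hτ).continuousAt.pow 2
  have ht : Tendsto (fun s : ℝ => τ - s) (𝓝[>] 0) (𝓝 τ) := by
    have : Continuous fun s : ℝ => τ - s := by fun_prop
    simpa using (this.tendsto 0).mono_left nhdsWithin_le_nhds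
  refine tendsto_nhds_unique ((hc1.tendsto.comp ht).congr' ?_) (hc2.tendsto.comp ht)
  have hp : 0 < τ.im ^ 2 := by positivity
  -- A left shift by s stays outside the circle as soon as s - s² < (Im τ)².
  filter_upwards [Ioo_mem_nhdsGT (show (0 : ℝ) < 1 by norm_num), Ioo_mem_nhdsGT hp] with s hs hs'
  apply hF.comp_lamC
  have h3 : (τ - s).re = 1 - s := by simp [h]
  have h4 : (τ - s).im = τ.im := by simp
  apply rightRegion_subset_fundInterior
  refine ⟨?_, ?_, ?_, ?_⟩
  · rw [h3]; linarith [hs.2]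
  · rw [h3]; linarith [hs.1]
  · rwa [h4]
  · rw [h3, h4]
    have := sq_nonneg s
    linarith [hs'.2]

/-- Points just right of the line are translated by -2 into the left half of the region; λ and ϑ₀₀
both have period 2. -/
lemma eventually_comp_lamC_of_re_eq_one (hF : IsHGFOffCut F) {τ : ℂ} (hτ : 0 < τ.im)
    (h : τ.re = 1) : ∀ᶠ z in 𝓝 τ, F (lamC z) = th00 z ^ 2 := by
  have hr := Complex.continuous_re
  have hi := Complex.continuous_im
  have e : ∀ z : ℂ, th00 (z - 2) = th00 z := fun z => by
    rw [th00, th00, ← jacobiTheta₂_add_right, sub_add_cancel]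
  have h1 : ∀ᶠ z in 𝓝 τ, z.re < 1 → z ∈ fundInterior := by
    have hm : ∀ᶠ z in 𝓝 τ, 0 < z.re ∧ 0 < z.im ∧ z.re < z.re ^ 2 + z.im ^ 2 := by
      refine (((isOpen_lt continuous_const hr).inter ((isOpen_lt continuous_const hi).inter
        (isOpen_lt hr ((hr.pow 2).add (hi.pow 2))))).mem_nhds ⟨?_, hτ, ?_⟩)
      · simp [h]
      · have : 0 < τ.im ^ 2 := by positivity
        simpa [h] using this
    filter_upwards [hm] with z hz hz1
    exact rightRegion_subset_fundInterior ⟨hz.1, hz1, hz.2⟩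
  have h2 : ∀ᶠ z in 𝓝 τ, 1 < z.re → z - 2 ∈ fundInterior := by
    have hm : ∀ᶠ z in 𝓝 τ, (z - 2).re < 0 ∧ 0 < (z - 2).im ∧
        -(z - 2).re < (z - 2).re ^ 2 + (z - 2).im ^ 2 := by
      have hc : Continuous fun z : ℂ => z - 2 := by fun_prop
      have hs2 : (τ - 2).re = -1 := by simp [h]; norm_num
      refine (((isOpen_lt hr continuous_const).inter ((isOpen_lt continuous_const hi).inter
        (isOpen_lt hr.neg ((hr.pow 2).add (hi.pow 2))))).preimage hc).mem_nhds ⟨?_, ?_, ?_⟩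
      · change (τ - 2).re < 0
        rw [hs2]; norm_num
      · simpa using hτ
      · change -(τ - 2).re < (τ - 2).re ^ 2 + (τ - 2).im ^ 2
        have : 0 < τ.im ^ 2 := by positivity
        have him : (τ - 2).im = τ.im := by simp
        rw [hs2, him]
        linarith
    filter_upwards [hm] with z ⟨hz1, hz2, hz3⟩ hz
    refine ⟨?_, ?_, hz2, ?_, hz3⟩
    · simp; linarith
    · linarith
    · have : 0 < (z - 2).im ^ 2 := by positivity
      have := sq_nonneg (z - 2).re
      linarith
  filter_upwards [h1, h2, isOpen_im_pos.mem_nhds hτ] with z hz1 hz2 hz3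
  rcases lt_trichotomy z.re 1 with h0 | h0 | h0
  · exact hF.comp_lamC (hz1 h0)
  · exact hF.comp_lamC_of_re_eq_one hz3 h0
  · rw [← lamC_sub_two, ← e]
    exact hF.comp_lamC (hz2 h0)

end IsHGFOffCut

/-! ### The circular boundary -/

lemma neg_inv_re_of_circle {τ : ℂ} (hτ : 0 < τ.im) (h : τ.re = τ.re ^ 2 + τ.im ^ 2) :
    (-1 / τ).re = -1 := by
  have : 0 < τ.im ^ 2 := by positivity
  rw [neg_inv_re, ← h, div_self]
  have := sq_nonneg τ.re
  linarith

lemma continuousAt_neg_inv {τ : ℂ} (hτ : 0 < τ.im) : ContinuousAt (fun z : ℂ => -1 / z) τ :=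
  continuousAt_const.div continuousAt_id (ne_zero_of_im_pos hτ)

/-- Near the circle `|τ - 1/2| = 1/2`, the imaginary part of `λ` is negative inside. -/
lemma eventually_lamC_im_neg {τ : ℂ} (hτ : 0 < τ.im) (h : τ.re = τ.re ^ 2 + τ.im ^ 2) :
    ∀ᶠ z in 𝓝 τ, z.re ^ 2 + z.im ^ 2 < z.re → (lamC z).im < 0 := by
  have hc : ContinuousAt (fun z : ℂ => -1 / z + 2) τ := (continuousAt_neg_inv hτ).add_const 2
  have hr := Complex.continuous_re
  have hi := Complex.continuous_im
  have h1 := neg_inv_re_of_circle hτ h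
  have h2 := im_neg_inv_pos hτ
  have hre : (-1 / τ + 2).re = 1 := by
    rw [Complex.add_re, h1]
    norm_num
  have him : (-1 / τ + 2).im = (-1 / τ).im := by simp
  have hm : ∀ᶠ z in 𝓝 (-1 / τ + 2), 0 < z.re ∧ z.re < z.re ^ 2 + z.im ^ 2 := by
    refine ((isOpen_lt continuous_const hr).inter
        (isOpen_lt hr ((hr.pow 2).add (hi.pow 2)))).mem_nhds ⟨?_, ?_⟩
    · change 0 < (-1 / τ + 2).re
      rw [hre]; norm_num
    · change (-1 / τ + 2).re < (-1 / τ + 2).re ^ 2 + (-1 / τ + 2).im ^ 2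
      rw [hre, him]
      have : 0 < (-1 / τ).im ^ 2 := by positivity
      linarith
  filter_upwards [hc.eventually hm, isOpen_im_pos.mem_nhds hτ] with z hz hz0 hz1
  have hz0' : 0 < z.im := hz0
  have hp : 0 < z.re ^ 2 + z.im ^ 2 := by positivity
  have hlt : (-1 / z + 2).re < 1 := by
    rw [Complex.add_re, neg_inv_re]
    have : 1 < z.re / (z.re ^ 2 + z.im ^ 2) := (one_lt_div hp).2 hz1
    norm_num
    linarith
  have h3 := lamC_im_pos (τ := -1 / z + 2)
    ⟨hz.1, hlt, by simpa using im_neg_inv_pos hz0', hz.2⟩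
  rw [lamC_add_two, lamC_neg_inv hz0'] at h3
  simpa using h3

lemma lamC_of_circle {τ : ℂ} (hτ : 0 < τ.im) (h : τ.re = τ.re ^ 2 + τ.im ^ 2) :
    ∃ t : ℝ, 1 < t ∧ lamC τ = t := by
  obtain ⟨r, hr, e⟩ := lamC_of_re_eq_one (τ := -1 / τ + 2)
    (by simpa using im_neg_inv_pos hτ) (by
      rw [Complex.add_re, neg_inv_re_of_circle hτ h]
      norm_num)
  rw [lamC_add_two, lamC_neg_inv hτ] at e
  refine ⟨1 - r, by linarith, ?_⟩
  push_cast
  rw [← e]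
  ring

lemma eventually_mem_rightRegion_of_circle {τ : ℂ} (hτ : 0 < τ.im)
    (h : τ.re = τ.re ^ 2 + τ.im ^ 2) :
    ∀ᶠ z in 𝓝 τ, z.re < z.re ^ 2 + z.im ^ 2 → z ∈ rightRegion := by
  have hr := Complex.continuous_re
  have hi := Complex.continuous_im
  have hp : 0 < τ.im ^ 2 := by positivity
  have h0 : 0 < τ.re := by
    have := sq_nonneg τ.re
    linarith
  have h1 : τ.re < 1 := by
    by_contra! h1
    have := mul_le_mul_of_nonneg_right h1 h0.le
    rw [sq] at h
    linarith
  have hm : ∀ᶠ z in 𝓝 τ, 0 < z.re ∧ z.re < 1 ∧ 0 < z.im :=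
    ((isOpen_lt continuous_const hr).inter ((isOpen_lt hr continuous_const).inter
      (isOpen_lt continuous_const hi))).mem_nhds ⟨h0, h1, hτ⟩
  filter_upwards [hm] with z ⟨k0, k1, k2⟩ hz
  exact ⟨k0, k1, k2, hz⟩

/-- Since λ is open, neighbourhoods of λ(τ) are images of neighbourhoods of τ. Where Im λ > 0 the
preimage lies strictly outside the circle, and there the interior formula holds. -/
lemma IsHGFOffCut.tendsto_of_circle {F : ℂ → ℂ} (hF : IsHGFOffCut F) {τ : ℂ} (hτ : 0 < τ.im)
    (h : τ.re = τ.re ^ 2 + τ.im ^ 2) :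
    Tendsto F (𝓝[{w : ℂ | 0 < w.im}] (lamC τ)) (𝓝 (th00 τ ^ 2)) := by
  have hc2 : ContinuousAt (fun τ => th00 τ ^ 2) τ := (differentiableAt_th00 hτ).continuousAt.pow 2
  rw [nhdsWithin, ← map_lamC_nhds hτ, ← map_inf_principal_preimage, tendsto_map'_iff]
  refine (hc2.tendsto.mono_left inf_le_left).congr' ?_
  filter_upwards [inf_le_left (b := 𝓟 (lamC ⁻¹' {w : ℂ | 0 < w.im})) (eventually_lamC_im_neg hτ h),
    inf_le_left (b := 𝓟 (lamC ⁻¹' {w : ℂ | 0 < w.im})) (eventually_mem_rightRegion_of_circle hτ h),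
    inf_le_left (b := 𝓟 (lamC ⁻¹' {w : ℂ | 0 < w.im})) (isOpen_im_pos.mem_nhds hτ),
    inf_le_right (a := 𝓝 τ) (mem_principal_self (lamC ⁻¹' {w : ℂ | 0 < w.im}))] with z h1 h2 h3 h4
  have h4' : 0 < (lamC z).im := h4
  refine (hF.comp_lamC (rightRegion_subset_fundInterior (h2 ?_))).symm
  rcases lt_trichotomy z.re (z.re ^ 2 + z.im ^ 2) with h0 | h0 | h0
  · exact h0
  · exact absurd (lamC_im_of_norm_sub_half_eq h3 h0) h4'.ne'
  · exact absurd (h1 h0) h4'.not_gt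

/-! ### Existence of the single-valued function -/

/-- Intermediate values on the imaginary axis: λ tends to 0 at i∞ and, by inversion, comes
arbitrarily close to 1 near 0. -/
lemma exists_lamC_imaginary_eq {r : ℝ} (h0 : 0 < r) (h1 : r < 1) :
    ∃ y : ℝ, 0 < y ∧ lamC (y * Complex.I) = r := by
  set f : ℝ → ℝ := fun y => (lamC (y * Complex.I)).re
  have hf : ContinuousOn f (Ioi 0) := by
    intro y hy
    have hy' : 0 < ((y : ℂ) * Complex.I).im := by simpa using hy
    have h2 : ContinuousAt (fun y : ℝ => (y : ℂ) * Complex.I) y := by fun_prop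
    exact (Complex.continuous_re.continuousAt.comp
      (ContinuousAt.comp (f := fun y : ℝ => (y : ℂ) * Complex.I)
        (differentiableAt_lamC hy').continuousAt h2)).continuousWithinAt
  have ht : Tendsto f atTop (𝓝 0) := by
    have h3 : Tendsto (fun y : ℝ => (y : ℂ) * Complex.I) atTop (comap Complex.im atTop) := by
      rw [tendsto_comap_iff]
      refine tendsto_id.congr fun y => by simp
    exact (Complex.continuous_re.tendsto 0).comp (tendsto_lamC.comp h3)
  obtain ⟨a, ha, ha0⟩ := ((ht.eventually (gt_mem_nhds h0)).and (eventually_gt_atTop 0)).exists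
  obtain ⟨b, hb, hb0⟩ := ((ht.eventually (gt_mem_nhds (sub_pos.2 h1))).and
    (eventually_gt_atTop 0)).exists
  have hb' : r < f b⁻¹ := by
    have h4 := lamC_neg_inv (τ := b * Complex.I) (by simpa using hb0)
    have h5 : -1 / ((b : ℂ) * Complex.I) = (b⁻¹ : ℝ) * Complex.I := by
      have : (b : ℂ) ≠ 0 := by exact_mod_cast hb0.ne'
      rw [div_eq_iff (mul_ne_zero this Complex.I_ne_zero)]
      push_cast
      field_simp
      simp
    rw [h5] at h4
    have h6 : f b⁻¹ = 1 - f b := by simp only [f, h4]; simp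
    linarith
  obtain ⟨y, hy, hfy⟩ := isPreconnected_Ioi.intermediate_value (s := Ioi (0 : ℝ)) ha0
    (show b⁻¹ ∈ Ioi (0 : ℝ) from inv_pos.2 hb0) hf ⟨ha.le, hb'.le⟩
  refine ⟨y, hy, Complex.ext hfy ?_⟩
  rw [lamC_im_of_re_eq_zero (by simp), Complex.ofReal_im]

lemma exists_circle_lamC_eq {t : ℝ} (ht : 1 < t) :
    ∃ τ : ℂ, 0 < τ.im ∧ τ.re = τ.re ^ 2 + τ.im ^ 2 ∧ lamC τ = t := by
  have ht0 : 0 < t := by linarith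
  -- The map τ ↦ -1/(τ - 1) takes the imaginary axis to the circle and λ to 1/(1 - λ), which is t
  -- for this value.
  obtain ⟨y, hy, e⟩ := exists_lamC_imaginary_eq (r := 1 - 1 / t)
    (by rw [sub_pos, div_lt_one ht0]; exact ht) (by have : 0 < 1 / t := by positivity
                                                    linarith)
  have hyI : 0 < ((y : ℂ) * Complex.I).im := by simpa using hy
  have h1 : 0 < ((y : ℂ) * Complex.I - 1).im := by simpa using hy
  refine ⟨-1 / ((y : ℂ) * Complex.I - 1), im_neg_inv_pos h1, ?_, ?_⟩
  · rw [neg_inv_re, neg_inv_im]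
    have e1 : ((y : ℂ) * Complex.I - 1).re = -1 := by simp
    have e2 : ((y : ℂ) * Complex.I - 1).im = y := by simp
    rw [e1, e2]
    have : (-1 : ℝ) ^ 2 + y ^ 2 ≠ 0 := by positivity
    field_simp
  · have ht' : (t : ℂ) ≠ 0 := by exact_mod_cast ht0.ne'
    rw [lamC_neg_inv_sub_one hyI, e]
    push_cast
    field_simp
    ring

lemma nhdsWithin_im_pos_neBot (t : ℝ) : (𝓝[{w : ℂ | 0 < w.im}] (t : ℂ)).NeBot := by
  rw [← mem_closure_iff_nhdsWithin_neBot, Complex.closure_setOfPred_lt_im]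
  simp

lemma mem_compl_cut_of_im_pos {w : ℂ} (h : 0 < w.im) : w ∈ cutᶜ := fun h' => h.ne' h'.1

/-- On the cut the function is defined as the limit from above. For t > 1 that limit exists because
t is the value of λ at a point of the circle. -/
lemma exists_isSingleValuedHGF : ∃ F, IsSingleValuedHGF (1 / 2) (1 / 2) 1 F := by
  classical
  refine ⟨fun z => if z ∈ cut then limUnder (𝓝[{w : ℂ | 0 < w.im}] z) eulerInt else eulerInt z,
    ?_, ?_, ?_⟩
  · exact differentiableOn_eulerInt.congr fun z hz => if_neg hz
  · intro z hz
    rw [if_neg (mem_compl_cut_of_norm_lt_one hz), eulerInt_eq hz]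
  · intro t ht
    have hcut : (t : ℂ) ∈ cut := ⟨by simp, by simpa using ht.le⟩
    obtain ⟨τ, hτ, hc, e⟩ := exists_circle_lamC_eq ht
    have h1 := isHGFOffCut_eulerInt.tendsto_of_circle hτ hc
    rw [e] at h1
    have := nhdsWithin_im_pos_neBot t
    simp only [if_pos hcut]
    rw [h1.limUnder_eq]
    refine h1.congr' ?_
    filter_upwards [self_mem_nhdsWithin] with w hw
    exact (if_neg (mem_compl_cut_of_im_pos hw)).symm

lemma isSingleValuedHGF_hgf : IsSingleValuedHGF (1 / 2) (1 / 2) 1 (hgf (1 / 2) (1 / 2) 1) :=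
  Classical.epsilon_spec exists_isSingleValuedHGF

lemma isHGFOffCut_hgf : IsHGFOffCut (hgf (1 / 2) (1 / 2) 1) :=
  ⟨isSingleValuedHGF_hgf.differentiableOn, isSingleValuedHGF_hgf.eq_series⟩

lemma hgf_lamC_of_circle {τ : ℂ} (hτ : 0 < τ.im) (h : τ.re = τ.re ^ 2 + τ.im ^ 2) :
    hgf (1 / 2) (1 / 2) 1 (lamC τ) = th00 τ ^ 2 := by
  obtain ⟨t, ht, e⟩ := lamC_of_circle hτ h
  have h1 := isHGFOffCut_hgf.tendsto_of_circle hτ h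
  rw [e] at h1 ⊢
  have := nhdsWithin_im_pos_neBot t
  exact tendsto_nhds_unique (isSingleValuedHGF_hgf.tendsto_cut t ht) h1

/-- Near a point of the fundamental region, `ϑ₀₀² = F(1/2,1/2,1;λ)`, on the side `Im ≥ 0` if `λ`
takes a value in `[1, ∞)` there. -/
lemma eventually_hgf_lamC {τ : ℍ} (hτ : τ ∈ D2) :
    ∀ᶠ z in 𝓝 (τ : ℂ), (lamC τ ∈ cut → 0 ≤ (lamC z).im) →
      hgf (1 / 2) (1 / 2) 1 (lamC z) = th00 z ^ 2 := by
  obtain ⟨h0, h1, h2, h3⟩ := hτ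
  rw [normSq_le_iff_norm_sub_half] at h2
  have h4 : -(τ : ℂ).re < (τ : ℂ).re ^ 2 + (τ : ℂ).im ^ 2 := by
    have := (normSq_lt_iff_norm_sub_half (-(τ : ℂ))).1 (by
      rwa [show -(τ : ℂ) - 1 / 2 = -((τ : ℂ) + 1 / 2) by ring, norm_neg])
    simpa using this
  have hτ : 0 < (τ : ℂ).im := τ.im_pos
  rcases h1.eq_or_lt with h1 | h1
  · filter_upwards [isHGFOffCut_hgf.eventually_comp_lamC_of_re_eq_one hτ h1] with z hz _
    exact hz
  rcases h2.eq_or_lt with h2 | h2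
  · have hcut : lamC τ ∈ cut := by
      obtain ⟨t, ht, e⟩ := lamC_of_circle hτ h2
      rw [e]
      exact ⟨by simp, by simpa using ht.le⟩
    filter_upwards [eventually_lamC_im_neg hτ h2, eventually_mem_rightRegion_of_circle hτ h2,
      isOpen_im_pos.mem_nhds hτ] with z k1 k2 k3 k4
    rcases lt_trichotomy z.re (z.re ^ 2 + z.im ^ 2) with k0 | k0 | k0
    · exact isHGFOffCut_hgf.comp_lamC (rightRegion_subset_fundInterior (k2 k0))
    · exact hgf_lamC_of_circle k3 k0
    · exact absurd (k1 k0) (k4 hcut).not_gt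
  · filter_upwards [isOpen_fundInterior.mem_nhds
      (show (τ : ℂ) ∈ fundInterior from ⟨h0, h1, hτ, h2, h4⟩)] with z hz _
    exact isHGFOffCut_hgf.comp_lamC hz

lemma hgf_lamC {τ : ℍ} (hτ : τ ∈ D2) : hgf (1 / 2) (1 / 2) 1 (lamC τ) = th00 τ ^ 2 :=
  (eventually_hgf_lamC hτ).self_of_nhds fun h => h.1.ge

/-! ### The derivative of the lambda function -/

lemma neg_inv_mem_fundInterior {τ : ℂ} (h : τ ∈ fundInterior) : -1 / τ ∈ fundInterior := by
  obtain ⟨h0, h1, h2, h3, h4⟩ := h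
  have hp : 0 < τ.re ^ 2 + τ.im ^ 2 := by positivity
  have h5 : τ.re / (τ.re ^ 2 + τ.im ^ 2) < 1 := (div_lt_one hp).2 h3
  have h6 : -1 < τ.re / (τ.re ^ 2 + τ.im ^ 2) := by rw [lt_div_iff₀ hp]; linarith
  have h7 : (-(τ.re / (τ.re ^ 2 + τ.im ^ 2))) ^ 2 + (τ.im / (τ.re ^ 2 + τ.im ^ 2)) ^ 2
      = 1 / (τ.re ^ 2 + τ.im ^ 2) := by
    field_simp
  refine ⟨?_, ?_, im_neg_inv_pos h2, ?_, ?_⟩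
  · rw [neg_inv_re]; linarith
  · rw [neg_inv_re]; linarith
  · rw [neg_inv_re, neg_inv_im, h7, ← neg_div]
    exact div_lt_div_of_pos_right (by linarith) hp
  · rw [neg_inv_re, neg_inv_im, h7, neg_neg]
    exact div_lt_div_of_pos_right (by linarith) hp

/-- By Jacobi's formula at τ and -1/τ, F(1 - λ)/F(λ) = -iτ. Thus λ has a holomorphic left inverse up
to the factor -i, and the chain rule forbids λ′ = 0. -/
lemma deriv_lamC_ne_zero_of_mem {τ : ℂ} (h : τ ∈ fundInterior) : deriv lamC τ ≠ 0 := by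
  have hτ := h.2.2.1
  have hF := isHGFOffCut_eulerInt
  set u : ℂ → ℂ := fun w => eulerInt (1 - w) / eulerInt w
  have hd : ∀ w ∈ cutᶜ, DifferentiableAt ℂ eulerInt w := fun w hw =>
    hF.differentiableOn.differentiableAt (isOpen_compl_cut.mem_nhds hw)
  have h1 : 1 - lamC τ ∈ cutᶜ := by
    rw [← lamC_neg_inv hτ]
    exact lamC_mem_compl_cut (neg_inv_mem_fundInterior h)
  have hu : DifferentiableAt ℂ u (lamC τ) := by
    refine DifferentiableAt.div ?_ (hd _ (lamC_mem_compl_cut h)) ?_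
    · exact DifferentiableAt.comp (f := fun w : ℂ => 1 - w) (lamC τ) (hd _ h1) (by fun_prop)
    · rw [hF.comp_lamC h]
      exact pow_ne_zero _ (th00_ne_zero hτ)
  have h2 := hu.hasDerivAt.comp τ (differentiableAt_lamC hτ).hasDerivAt
  have h3 : HasDerivAt (fun z : ℂ => -Complex.I * z) (-Complex.I) τ := by
    simpa using (hasDerivAt_id τ).const_mul (-Complex.I)
  have h4 : (fun z : ℂ => -Complex.I * z) =ᶠ[𝓝 τ] u ∘ lamC := by
    filter_upwards [isOpen_fundInterior.mem_nhds h] with z hz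
    have hz0 := th00_ne_zero hz.2.2.1
    simp only [u, Function.comp_apply]
    rw [← lamC_neg_inv hz.2.2.1, hF.comp_lamC hz, hF.comp_lamC (neg_inv_mem_fundInterior hz),
      th00_sq_neg_inv hz.2.2.1]
    field_simp
  have h5 := (h2.congr_of_eventuallyEq h4).unique h3
  intro h0
  rw [h0, mul_zero] at h5
  exact neg_ne_zero.2 Complex.I_ne_zero h5.symm

lemma deriv_lamC_add_one_ne_zero_iff {τ : ℂ} (hτ : 0 < τ.im) :
    deriv lamC (τ + 1) ≠ 0 ↔ deriv lamC τ ≠ 0 := by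
  have key : ∀ σ : ℂ, 0 < σ.im → deriv lamC (σ + 1) ≠ 0 → deriv lamC σ ≠ 0 := by
    intro σ hσ h h0
    apply h
    rw [← deriv_comp_add_const]
    have h1 : (fun z => lamC (z + 1)) =ᶠ[𝓝 σ] (fun w : ℂ => w / (w - 1)) ∘ lamC := by
      filter_upwards [isOpen_im_pos.mem_nhds hσ] with z hz
      exact lamC_add_one hz
    have h2 : DifferentiableAt ℂ (fun w : ℂ => w / (w - 1)) (lamC σ) :=
      DifferentiableAt.div (by fun_prop) (by fun_prop) (sub_ne_zero.2 (lamC_ne_one hσ))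
    rw [h1.deriv_eq, deriv_comp _ h2 (differentiableAt_lamC hσ), h0, mul_zero]
  have hper : deriv lamC (τ + 1 + 1) = deriv lamC τ := by
    rw [add_assoc, one_add_one_eq_two, ← deriv_comp_add_const]
    simp_rw [lamC_add_two]
  exact ⟨key τ hτ, fun h => key (τ + 1) (by simpa using hτ) (by rwa [hper])⟩

lemma deriv_lamC_neg_inv_ne_zero_iff {τ : ℂ} (hτ : 0 < τ.im) :
    deriv lamC (-1 / τ) ≠ 0 ↔ deriv lamC τ ≠ 0 := by
  have key : ∀ σ : ℂ, 0 < σ.im → deriv lamC σ ≠ 0 → deriv lamC (-1 / σ) ≠ 0 := by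
    intro σ hσ h h0
    apply h
    have h1 : lamC =ᶠ[𝓝 σ] fun z => 1 - (lamC ∘ fun z : ℂ => -1 / z) z := by
      filter_upwards [isOpen_im_pos.mem_nhds hσ] with z hz
      simp only [Function.comp_apply]
      rw [lamC_neg_inv hz]
      ring
    have h2 : DifferentiableAt ℂ (fun z : ℂ => -1 / z) σ :=
      DifferentiableAt.div (by fun_prop) (by fun_prop) (ne_zero_of_im_pos hσ)
    rw [h1.deriv_eq, deriv_const_sub,
      deriv_comp _ (differentiableAt_lamC (im_neg_inv_pos hσ)) h2, h0, zero_mul, neg_zero]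
  refine ⟨fun h => ?_, key τ hτ⟩
  have := key _ (im_neg_inv_pos hτ) h
  have h0 := ne_zero_of_im_pos hτ
  rwa [show -1 / (-1 / τ) = τ by field_simp] at this

lemma deriv_lamC_smul_ne_zero_iff (g : SL(2, ℤ)) (τ : ℍ) :
    deriv lamC ↑(g • τ) ≠ 0 ↔ deriv lamC τ ≠ 0 := by
  have hg : g ∈ Subgroup.closure {ModularGroup.S, ModularGroup.T} := by
    simp [SpecialLinearGroup.SL2Z_generators]
  induction hg using Subgroup.closure_induction generalizing τ with
  | mem x hx =>
    rcases hx with rfl | rfl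
    · rw [UpperHalfPlane.modular_S_smul, UpperHalfPlane.coe_mk,
        ← deriv_lamC_neg_inv_ne_zero_iff τ.im_pos]
      simp [neg_div, inv_neg]
    · rw [UpperHalfPlane.modular_T_smul, UpperHalfPlane.coe_vadd,
        ← deriv_lamC_add_one_ne_zero_iff τ.im_pos, add_comm]
      simp
  | one => rw [one_smul]
  | mul x y _ _ hx hy =>
    rw [mul_smul]
    exact (hx (y • τ)).trans (hy τ)
  | inv x _ hx =>
    have := hx (x⁻¹ • τ)
    rw [smul_inv_smul] at this
    exact this.symm

/-- The standard fundamental domain of SL₂(ℤ) lies inside `fundInterior`, and nonvanishing of λ′ is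
invariant under SL₂(ℤ). -/
lemma deriv_lamC_ne_zero (τ : ℍ) : deriv lamC τ ≠ 0 := by
  obtain ⟨g, hg1, hg2⟩ := ModularGroup.exists_smul_mem_fd τ
  rw [← deriv_lamC_smul_ne_zero_iff g]
  rw [Complex.normSq_apply, ← sq, ← sq] at hg1
  have := abs_le.1 hg2
  apply deriv_lamC_ne_zero_of_mem
  refine ⟨?_, ?_, (g • τ).im_pos, ?_, ?_⟩ <;> rw [UpperHalfPlane.coe_re] <;>
    simp only [UpperHalfPlane.coe_re, UpperHalfPlane.coe_im] at * <;> linarith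

/-! ### The action of `Γ(2,4)` -/

/-- The automorphy factor `g₂₁ τ + g₂₂`. -/
noncomputable def autFactor (g : SL(2, ℤ)) (τ : ℍ) : ℂ := (g 1 0 : ℂ) * τ + (g 1 1 : ℂ)

lemma coe_smul_eq (g : SL(2, ℤ)) (τ : ℍ) :
    ((g • τ : ℍ) : ℂ) = ((g 0 0 : ℂ) * τ + (g 0 1 : ℂ)) / autFactor g τ := by
  rw [UpperHalfPlane.coe_specialLinearGroup_apply, autFactor]
  simp

lemma autFactor_eq_denom (g : SL(2, ℤ)) (τ : ℍ) : autFactor g τ = UpperHalfPlane.denom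
    (Matrix.SpecialLinearGroup.toGL ((Matrix.SpecialLinearGroup.map (Int.castRingHom ℝ)) g)) τ :=
  (ModularGroup.denom_apply g τ).symm

lemma autFactor_ne_zero (g : SL(2, ℤ)) (τ : ℍ) : autFactor g τ ≠ 0 := by
  rw [autFactor_eq_denom]
  exact UpperHalfPlane.denom_ne_zero _ τ

lemma im_smul_eq (g : SL(2, ℤ)) (τ : ℍ) :
    (g • τ).im = τ.im / Complex.normSq (autFactor g τ) := by
  rw [autFactor_eq_denom, ModularGroup.im_smul_eq_div_normSq]

lemma autFactor_mul (g h : SL(2, ℤ)) (τ : ℍ) :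
    autFactor (g * h) τ = autFactor g (h • τ) * autFactor h τ := by
  have h0 := autFactor_ne_zero h τ
  conv_rhs => rw [autFactor, coe_smul_eq, add_mul, mul_assoc, div_mul_cancel₀ _ h0]
  simp only [autFactor, Matrix.SpecialLinearGroup.coe_mul, Matrix.mul_apply, Fin.sum_univ_two]
  push_cast
  ring

lemma autFactor_one (τ : ℍ) : autFactor 1 τ = 1 := by
  simp [autFactor]

lemma det_eq_one (g : SL(2, ℤ)) : g 0 0 * g 1 1 - g 0 1 * g 1 0 = 1 := by
  rw [← Matrix.det_fin_two]
  exact g.2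

/-- The left side is the automorphy factor of g⁻¹ at g • τ, so this is the cocycle relation for g⁻¹g
= 1. -/
lemma autFactor_inv_smul (g : SL(2, ℤ)) (τ : ℍ) :
    -(g 1 0 : ℂ) * ((g • τ : ℍ) : ℂ) + (g 0 0 : ℂ) = (autFactor g τ)⁻¹ := by
  have h0 := autFactor_ne_zero g τ
  have hdet : (g 0 0 : ℂ) * g 1 1 - g 0 1 * g 1 0 = 1 := by exact_mod_cast det_eq_one g
  refine eq_inv_of_mul_eq_one_left ?_
  rw [coe_smul_eq, add_mul, mul_assoc, div_mul_cancel₀ _ h0, autFactor]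
  linear_combination hdet

/-- The elements of `SL₂(ℤ)` under which `ϑ₀₀²` has weight one without multiplier and
`λ` is invariant. -/
def thetaGroup : Subgroup SL(2, ℤ) where
  carrier := {g | ∀ τ : ℍ, th00 ↑(g • τ) ^ 2 = autFactor g τ * th00 τ ^ 2 ∧
    lamC ↑(g • τ) = lamC τ}
  one_mem' τ := by simp [autFactor_one]
  mul_mem' {g h} hg hh τ := by
    rw [mul_smul, (hg _).1, (hh _).1, (hg _).2, (hh _).2, autFactor_mul, mul_assoc]
    exact ⟨rfl, rfl⟩
  inv_mem' {g} hg τ := by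
    have h1 := hg (g⁻¹ • τ)
    have h2 := autFactor_mul g g⁻¹ τ
    rw [mul_inv_cancel, autFactor_one] at h2
    rw [smul_inv_smul] at h1
    refine ⟨?_, h1.2.symm⟩
    rw [h1.1, ← mul_assoc, mul_comm (autFactor _ _), ← h2, one_mul]

/-- The matrix `(1, 2k; 0, 1)`. -/
def upperTri (k : ℤ) : SL(2, ℤ) := ⟨!![1, 2 * k; 0, 1], by simp [Matrix.det_fin_two]⟩

/-- The matrix `(1, 0; 2k, 1)`. -/
def lowerTri (k : ℤ) : SL(2, ℤ) := ⟨!![1, 0; 2 * k, 1], by simp [Matrix.det_fin_two]⟩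

lemma upperTri_mem_Gamma24 (k : ℤ) : upperTri k ∈ Gamma24 := by
  refine ⟨?_, ?_, ?_, ?_⟩ <;> simp [upperTri, Int.ModEq]

lemma lowerTri_mem_Gamma24 (k : ℤ) : lowerTri k ∈ Gamma24 := by
  refine ⟨?_, ?_, ?_, ?_⟩ <;> simp [lowerTri, Int.ModEq]

lemma coe_upperTri_smul (k : ℤ) (τ : ℍ) : ((upperTri k • τ : ℍ) : ℂ) = τ + k * 2 := by
  rw [coe_smul_eq]
  simp [autFactor, upperTri, mul_comm]

lemma coe_lowerTri_smul (k : ℤ) (τ : ℍ) :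
    ((lowerTri k • τ : ℍ) : ℂ) = τ / autFactor (lowerTri k) τ := by
  rw [coe_smul_eq]
  simp [lowerTri]

lemma autFactor_lowerTri (k : ℤ) (τ : ℍ) : autFactor (lowerTri k) τ = 2 * k * τ + 1 := by
  simp [autFactor, lowerTri]

lemma th00_add_int_mul_two (τ : ℂ) (k : ℤ) : th00 (τ + k * 2) = th00 τ :=
  (show Function.Periodic th00 2 from fun τ => jacobiTheta₂_add_right 0 τ).int_mul k τ

lemma lamC_add_int_mul_two (τ : ℂ) (k : ℤ) : lamC (τ + k * 2) = lamC τ :=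
  (show Function.Periodic lamC 2 from lamC_add_two).int_mul k τ

lemma upperTri_mem_thetaGroup (k : ℤ) : upperTri k ∈ thetaGroup := by
  intro τ
  rw [coe_upperTri_smul, th00_add_int_mul_two, lamC_add_int_mul_two]
  simp [autFactor, upperTri]

/-- Conjugation by inversion turns this matrix into the translation by -2k, a period of ϑ₀₀ and λ.
-/
lemma lowerTri_mem_thetaGroup (k : ℤ) : lowerTri k ∈ thetaGroup := by
  intro τ
  set w : ℂ := ↑(lowerTri k • τ) with hw
  have hτ : 0 < (τ : ℂ).im := τ.im_pos
  have hwp : 0 < w.im := (lowerTri k • τ).im_pos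
  have h0 := autFactor_ne_zero (lowerTri k) τ
  have hτ0 := ne_zero_of_im_pos hτ
  have h1 : -1 / (τ : ℂ) = -1 / w + k * 2 := by
    rw [hw, coe_lowerTri_smul]
    field_simp
    rw [autFactor_lowerTri]
    ring
  have h2 : -Complex.I * τ * th00 τ ^ 2 = -Complex.I * w * th00 w ^ 2 := by
    rw [← th00_sq_neg_inv hτ, ← th00_sq_neg_inv hwp, h1, th00_add_int_mul_two]
  constructor
  · have h3 : w * autFactor (lowerTri k) τ = τ := by
      rw [hw, coe_lowerTri_smul, div_mul_cancel₀ _ h0]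
    have hw0 := ne_zero_of_im_pos hwp
    have h4 : w * th00 w ^ 2 = τ * th00 τ ^ 2 := by
      have := mul_left_cancel₀ (neg_ne_zero.2 Complex.I_ne_zero)
        ((mul_assoc _ _ _).symm.trans (h2.trans (mul_assoc _ _ _)))
      exact this.symm
    apply mul_left_cancel₀ hw0
    rw [h4, ← mul_assoc, h3]
  · have h5 := lamC_neg_inv hτ
    rw [h1, lamC_add_int_mul_two, lamC_neg_inv hwp] at h5
    linear_combination -h5

/-- One step of division with even quotients: adding 2d with sign opposite to c shrinks |c|. -/
lemma exists_natAbs_add_lt {c d : ℤ} (h0 : d ≠ 0) (h : d.natAbs < c.natAbs) :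
    ∃ k : ℤ, (c + 2 * k * d).natAbs < c.natAbs := by
  by_cases h1 : (c + 2 * d).natAbs < c.natAbs
  · exact ⟨1, by simpa using h1⟩
  · refine ⟨-1, ?_⟩
    rw [show c + 2 * -1 * d = c - 2 * d by ring]
    omega

/-- Euclidean descent on the bottom row (c, d): right multiplication by triangular matrices reduces
whichever entry is larger in absolute value, until c = 0. -/
lemma mem_thetaGroup_of_natAbs_le (n : ℕ) : ∀ g ∈ Gamma24,
    (g 1 0).natAbs + (g 1 1).natAbs ≤ n → g ∈ thetaGroup := by
  induction n with
  | zero =>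
    intro g hg hn
    have := hg.2.1
    simp only [Int.ModEq] at this
    omega
  | succ n ih =>
    intro g hg hn
    have hd := hg.2.1
    have hc := hg.2.2.2
    have hb := hg.2.2.1
    have hdet := det_eq_one g
    simp only [Int.ModEq] at hd hc hb
    have step : ∀ h ∈ Gamma24, h ∈ thetaGroup →
        ((g * h) 1 0).natAbs + ((g * h) 1 1).natAbs ≤ n → g ∈ thetaGroup := by
      intro h hh hh' hle
      rw [← mul_inv_cancel_right g h]
      exact thetaGroup.mul_mem (ih _ (Gamma24.mul_mem hg hh) hle) (thetaGroup.inv_mem hh')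
    by_cases h0 : g 1 0 = 0
    · have h11 : g 1 1 = 1 := by
        rw [h0, mul_zero, sub_zero] at hdet
        rcases Int.isUnit_iff.1 (IsUnit.of_mul_eq_one_right _ hdet) with h | h
        · exact h
        -- The condition mod 4, not merely mod 2, excludes -1 here; -1 would change the sign of the
        -- automorphy factor.
        · rw [h] at hd; norm_num at hd
      have h00 : g 0 0 = 1 := by simpa [h0, h11] using hdet
      obtain ⟨k, hk⟩ := Int.dvd_of_emod_eq_zero hb
      have : g = upperTri k := by
        ext i j
        fin_cases i <;> fin_cases j <;> simp [upperTri, h0, h11, h00, hk]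
      rw [this]
      exact upperTri_mem_thetaGroup k
    · rcases lt_trichotomy (g 1 0).natAbs (g 1 1).natAbs with h | h | h
      · obtain ⟨k, hk⟩ := exists_natAbs_add_lt h0 h
        refine step _ (upperTri_mem_Gamma24 k) (upperTri_mem_thetaGroup k) ?_
        have e1 : (g * upperTri k) 1 0 = g 1 0 := by
          rw [Matrix.SpecialLinearGroup.coe_mul, Matrix.mul_apply, Fin.sum_univ_two]
          simp [upperTri]
        have e2 : (g * upperTri k) 1 1 = g 1 1 + 2 * k * g 1 0 := by
          rw [Matrix.SpecialLinearGroup.coe_mul, Matrix.mul_apply, Fin.sum_univ_two]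
          simp [upperTri]
          ring
        rw [e1, e2]
        omega
      -- Equality cannot occur: g₂₁ is even and g₂₂ is odd.
      · omega
      · obtain ⟨k, hk⟩ := exists_natAbs_add_lt (by omega) h
        refine step _ (lowerTri_mem_Gamma24 k) (lowerTri_mem_thetaGroup k) ?_
        have e1 : (g * lowerTri k) 1 0 = g 1 0 + 2 * k * g 1 1 := by
          rw [Matrix.SpecialLinearGroup.coe_mul, Matrix.mul_apply, Fin.sum_univ_two]
          simp [lowerTri]
          ring
        have e2 : (g * lowerTri k) 1 1 = g 1 1 := by
          rw [Matrix.SpecialLinearGroup.coe_mul, Matrix.mul_apply, Fin.sum_univ_two]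
          simp [lowerTri]
        rw [e1, e2]
        omega

lemma Gamma24_le_thetaGroup : Gamma24 ≤ thetaGroup := fun g hg =>
  mem_thetaGroup_of_natAbs_le _ g hg le_rfl

/-! ### The fundamental region -/

/-- Maximising Im(g • τ) means minimising |cτ + d|² over the bottom rows of Γ(2,4), a quantity that
tends to infinity on integer pairs. -/
lemma exists_max_im_Gamma24 (τ : ℍ) :
    ∃ g ∈ Gamma24, ∀ g' ∈ Gamma24, (g' • τ).im ≤ (g • τ).im := by
  obtain ⟨p, ⟨g, hg, rfl⟩, hp⟩ := Filter.Tendsto.exists_within_forall_le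
    (s := (fun g : SL(2, ℤ) => (g 1 : Fin 2 → ℤ)) '' Gamma24) ⟨_, 1, Gamma24.one_mem, rfl⟩
    (ModularGroup.tendsto_normSq_coprime_pair τ)
  refine ⟨g, hg, fun g' hg' => ?_⟩
  rw [im_smul_eq, im_smul_eq]
  exact div_le_div_of_nonneg_left τ.im_pos.le
    (Complex.normSq_pos.2 (autFactor_ne_zero g τ)) (hp _ ⟨g', hg', rfl⟩)

lemma half_le_norm_of_im_lowerTri_le {τ : ℍ} {k : ℤ} (hk : ‖(2 * k : ℂ)‖ = 2)
    (h : (lowerTri k • τ).im ≤ τ.im) : 1 / 2 ≤ ‖(τ : ℂ) + 1 / (2 * k)‖ := by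
  have h0 : (2 * k : ℂ) ≠ 0 := by
    intro h; rw [h] at hk; simp at hk
  rw [im_smul_eq, div_le_iff₀ (Complex.normSq_pos.2 (autFactor_ne_zero _ τ))] at h
  have h1 : 1 ≤ ‖autFactor (lowerTri k) τ‖ := by
    rw [← one_le_sq_iff₀ (norm_nonneg _), Complex.sq_norm]
    exact le_of_mul_le_mul_left (by simpa using h) τ.im_pos
  have h2 : autFactor (lowerTri k) τ = 2 * k * ((τ : ℂ) + 1 / (2 * k)) := by
    rw [autFactor_lowerTri, mul_add, mul_one_div_cancel h0]
  rw [h2, norm_mul, hk] at h1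
  linarith

lemma exists_D2_smul_eq (τ : ℍ) : ∃ τ₀ ∈ D2, ∃ g ∈ Gamma24, τ = g • τ₀ := by
  suffices h : ∃ g ∈ Gamma24, g • τ ∈ D2 by
    obtain ⟨g, hg, h⟩ := h
    exact ⟨g • τ, h, g⁻¹, Gamma24.inv_mem hg, by simp⟩
  obtain ⟨g, hg, hmax⟩ := exists_max_im_Gamma24 τ
  obtain ⟨m, hm, -⟩ := existsUnique_add_zsmul_mem_Ioc (show (0 : ℝ) < 2 by norm_num) (g • τ).re (-1)
  set σ : ℍ := upperTri m • g • τ with hσ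
  have hσg : ∀ h ∈ Gamma24, (h • σ).im ≤ σ.im := by
    intro h hh
    have e : σ.im = (g • τ).im := by
      rw [← UpperHalfPlane.coe_im, hσ, coe_upperTri_smul]
      simp
    rw [e, hσ, smul_smul, smul_smul]
    exact hmax _ (Gamma24.mul_mem (Gamma24.mul_mem hh (upperTri_mem_Gamma24 m)) hg)
  have hre : -1 < σ.re ∧ σ.re ≤ 1 := by
    have e : σ.re = (g • τ).re + m • (2 : ℝ) := by
      rw [← UpperHalfPlane.coe_re, hσ, coe_upperTri_smul]
      simp
    rw [e]
    refine ⟨hm.1, hm.2.trans (by norm_num)⟩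
  have h1 : 1 / 2 ≤ ‖(σ : ℂ) + 1 / 2‖ := by
    simpa using half_le_norm_of_im_lowerTri_le (k := 1) (by simp)
      (hσg _ (lowerTri_mem_Gamma24 1))
  have h2 : 1 / 2 ≤ ‖(σ : ℂ) - 1 / 2‖ := by
    have := half_le_norm_of_im_lowerTri_le (k := -1) (by simp)
      (hσg _ (lowerTri_mem_Gamma24 (-1)))
    rwa [show (σ : ℂ) + 1 / (2 * ((-1 : ℤ) : ℂ)) = σ - 1 / 2 by push_cast; ring] at this
  rcases h1.lt_or_eq with h1 | h1
  · exact ⟨upperTri m * g, Gamma24.mul_mem (upperTri_mem_Gamma24 m) hg,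
      by rw [mul_smul]; exact ⟨hre.1, hre.2, h2, h1⟩⟩
  -- A point on the left circle, which 𝔻(2) omits, is moved by τ ↦ τ/(2τ + 1) to the right circle,
  -- which it includes.
  · refine ⟨lowerTri 1 * (upperTri m * g), Gamma24.mul_mem (lowerTri_mem_Gamma24 1)
      (Gamma24.mul_mem (upperTri_mem_Gamma24 m) hg), ?_⟩
    rw [mul_smul, mul_smul]
    change lowerTri 1 • σ ∈ D2
    have hne := autFactor_ne_zero (lowerTri 1) σ
    have hc := coe_lowerTri_smul 1 σ
    have ha := autFactor_lowerTri 1 σ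
    have hn : ‖autFactor (lowerTri 1) σ‖ = 1 := by
      rw [ha, show 2 * ((1 : ℤ) : ℂ) * (σ : ℂ) + 1 = 2 * ((σ : ℂ) + 1 / 2) by push_cast; ring,
        norm_mul, ← h1]
      simp
    have e1 : ‖((lowerTri 1 • σ : ℍ) : ℂ) - 1 / 2‖ = 1 / 2 := by
      have : ((lowerTri 1 • σ : ℍ) : ℂ) - 1 / 2 = -(1 / 2) / autFactor (lowerTri 1) σ := by
        rw [hc]
        field_simp
        rw [ha]
        push_cast
        ring
      rw [this, norm_div, hn]
      simp
    set w : ℍ := lowerTri 1 • σ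
    have hw : 0 < (w : ℂ).im := w.im_pos
    have e2 : (w : ℂ).re = (w : ℂ).re ^ 2 + (w : ℂ).im ^ 2 :=
      le_antisymm ((normSq_le_iff_norm_sub_half _).1 e1.ge) (not_lt.1 fun h =>
        ((normSq_lt_iff_norm_sub_half _).2 h).ne' e1)
    have hp : 0 < (w : ℂ).im ^ 2 := by positivity
    have hr0 : 0 < (w : ℂ).re := by
      have := sq_nonneg (w : ℂ).re
      linarith
    refine ⟨by rw [← UpperHalfPlane.coe_re]; linarith, ?_, e1.ge, ?_⟩
    · rw [← UpperHalfPlane.coe_re]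
      by_contra! h
      have := mul_le_mul_of_nonneg_right h.le hr0.le
      rw [sq] at e2
      linarith
    · have : 1 / 2 < ‖-(w : ℂ) - 1 / 2‖ := by
        rw [normSq_lt_iff_norm_sub_half]
        simp only [Complex.neg_re, Complex.neg_im, neg_sq]
        linarith
      rwa [show -(w : ℂ) - 1 / 2 = -((w : ℂ) + 1 / 2) by ring, norm_neg] at this

/-! ### Continuation along paths -/

/-- As λ′(τ) ≠ 0, λ has an analytic local inverse, and ϑ₀₀² composed with it is the germ. -/
lemma exists_germ (τ : ℍ) : ∃ f : ℂ → ℂ, AnalyticAt ℂ f (lamC τ) ∧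
    ∀ᶠ z in 𝓝 (τ : ℂ), f (lamC z) = th00 z ^ 2 := by
  have hτ : 0 < (τ : ℂ).im := τ.im_pos
  have ha := analyticOnNhd_lamC τ hτ
  have hd := deriv_lamC_ne_zero τ
  set s := ha.hasStrictDerivAt.localInverse _ _ _ hd
  have hs : ∀ᶠ z in 𝓝 (τ : ℂ), s (lamC z) = z :=
    HasStrictDerivAt.eventually_left_inverse ha.hasStrictDerivAt hd
  have hsa : AnalyticAt ℂ s (lamC τ) := ha.analyticAt_localInverse hd
  refine ⟨fun w => th00 (s w) ^ 2, ?_, ?_⟩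
  · refine AnalyticAt.pow (AnalyticAt.fun_comp ?_ hsa) 2
    rw [hs.self_of_nhds]
    exact analyticOnNhd_th00 τ hτ
  · filter_upwards [hs] with z hz
    rw [hz]

/-- Neighbouring germs agree because both pull back under the open map λ to the same function ϑ₀₀².
The initial germ is that of F by Jacobi's formula near 𝔻(2). -/
lemma exists_isContinuationAlong {τ τ₀ : ℍ} (h₀ : τ₀ ∈ D2) (γ : Path τ₀ τ) :
    IsContinuationValue (1 / 2) (1 / 2) 1 (fun t => lam (γ t)) (theta 0 0 τ ^ 2) := by
  choose f hfa hf using exists_germ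
  refine ⟨fun t => f (γ t), ⟨?_, ?_, ?_, ?_, ?_⟩, ?_⟩
  · simp_rw [lam_eq_lamC]
    refine continuous_iff_continuousAt.2 fun t => ?_
    exact ContinuousAt.comp (g := lamC) (f := fun t => (γ t : ℂ))
      (differentiableAt_lamC (γ t).im_pos).continuousAt
      (UpperHalfPlane.continuous_coe.comp γ.continuous).continuousAt
  · intro t
    simp_rw [lam_eq_lamC]
    exact ⟨lamC_ne_zero (γ t).im_pos, lamC_ne_one (γ t).im_pos⟩
  · intro t
    simp_rw [lam_eq_lamC]
    exact hfa _
  · intro t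
    have hc : Tendsto (fun s => (γ s : ℂ)) (𝓝 t) (𝓝 (γ t : ℂ)) :=
      (UpperHalfPlane.continuous_coe.comp γ.continuous).tendsto t
    filter_upwards [hc.eventually (hf (γ t)).eventually_nhds] with s hs
    simp_rw [lam_eq_lamC]
    rw [EventuallyEq, ← map_lamC_nhds (γ s).im_pos, eventually_map]
    filter_upwards [hs, hf (γ s)] with z h1 h2
    rw [h1, h2]
  · simp_rw [lam_eq_lamC, γ.source]
    rw [← map_lamC_nhds τ₀.im_pos, eventually_map]
    filter_upwards [hf τ₀, eventually_hgf_lamC h₀] with z h1 h2 h3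
    rw [h1, h2 h3]
  · simp_rw [γ.target, lam_eq_lamC]
    rw [(hf τ).self_of_nhds, theta_zero_zero]

/-- Agreement along the real line, which accumulates at z, already suffices. This covers
continuations that start on the cut, where the initial germ is prescribed on one side only. -/
lemma eventually_eq_of_eventually_eq_im_nonneg {f g : ℂ → ℂ} {z : ℂ} (hz : z.im = 0)
    (hf : AnalyticAt ℂ f z) (hg : AnalyticAt ℂ g z) (h : ∀ᶠ w in 𝓝 z, 0 ≤ w.im → f w = g w) :
    f =ᶠ[𝓝 z] g := by
  refine (hf.frequently_eq_iff_eventually_eq hg).1 ?_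
  have ht : Tendsto (fun s : ℝ => z + s) (𝓝[≠] 0) (𝓝[≠] z) := by
    refine tendsto_nhdsWithin_iff.2 ⟨?_, ?_⟩
    · have : Continuous fun s : ℝ => z + s := by fun_prop
      simpa using (this.tendsto 0).mono_left nhdsWithin_le_nhds
    · filter_upwards [self_mem_nhdsWithin] with s hs h
      exact hs (by simpa using h)
  refine ht.frequently (Eventually.frequently ?_)
  filter_upwards [(ht.mono_right nhdsWithin_le_nhds).eventually h] with s hs
  exact hs (by simp [hz])

/-- Analytic continuation along a path is unique. -/
lemma IsContinuationAlong.unique {a b c : ℂ} {ρ : unitInterval → ℂ} {f g : unitInterval → ℂ → ℂ}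
    (hf : IsContinuationAlong a b c ρ f) (hg : IsContinuationAlong a b c ρ g) (t : unitInterval) :
    f t =ᶠ[𝓝 (ρ t)] g t := by
  set A : Set unitInterval := {t | f t =ᶠ[𝓝 (ρ t)] g t}
  have hρ : ∀ t, Tendsto ρ (𝓝 t) (𝓝 (ρ t)) := fun t => hf.continuous.tendsto t
  have hopen : IsOpen A := by
    refine isOpen_iff_mem_nhds.2 fun t ht => ?_
    filter_upwards [hf.compatible t, hg.compatible t,
      (hρ t).eventually (EventuallyEq.eventuallyEq_nhds ht)] with s h1 h2 h3
    exact h1.trans (h3.trans h2.symm)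
  have hclosed : IsClosed A := by
    refine isClosed_iff_frequently.2 fun t ht => ?_
    obtain ⟨U, hU, hfU, hgU⟩ : ∃ r > 0, AnalyticOnNhd ℂ (f t) (Metric.ball (ρ t) r) ∧
        AnalyticOnNhd ℂ (g t) (Metric.ball (ρ t) r) := by
      have h1 := (hf.analyticAt t).eventually_analyticAt
      have h2 := (hg.analyticAt t).eventually_analyticAt
      obtain ⟨r, hr, h⟩ := Metric.eventually_nhds_iff_ball.1 (h1.and h2)
      exact ⟨r, hr, fun z hz => (h z hz).1, fun z hz => (h z hz).2⟩
    -- A nearby parameter s of agreement has ρ s in a disc where both germs at t are analytic; the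
    -- identity theorem spreads the agreement over the disc.
    obtain ⟨s, hs, h1, h2, h3⟩ := (ht.and_eventually ((hf.compatible t).and
      ((hg.compatible t).and ((hρ t).eventually (Metric.ball_mem_nhds _ hU))))).exists
    have h4 := hfU.eqOn_of_preconnected_of_eventuallyEq hgU
      (convex_ball (ρ t) U).isPreconnected h3 (h1.symm.trans (EventuallyEq.trans hs h2))
    exact h4.eventuallyEq_of_mem (Metric.ball_mem_nhds _ hU)
  have h0 : (0 : unitInterval) ∈ A := by
    have h := hf.initial.and hg.initial
    by_cases hcut : ρ 0 ∈ cut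
    · refine eventually_eq_of_eventually_eq_im_nonneg hcut.1 (hf.analyticAt 0) (hg.analyticAt 0) ?_
      filter_upwards [h] with w hw hw0
      rw [hw.1 fun _ => hw0, hw.2 fun _ => hw0]
    · filter_upwards [h] with w hw
      rw [hw.1 fun h => absurd h hcut, hw.2 fun h => absurd h hcut]
  have hA : A = univ := IsClopen.eq_univ ⟨hclosed, hopen⟩ ⟨0, h0⟩
  exact (hA.symm ▸ mem_univ t : t ∈ A)

lemma IsContinuationValue.unique {a b c : ℂ} {ρ : unitInterval → ℂ} {v w : ℂ}
    (hv : IsContinuationValue a b c ρ v) (hw : IsContinuationValue a b c ρ w) : v = w := by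
  obtain ⟨f, hf, rfl⟩ := hv
  obtain ⟨g, hg, rfl⟩ := hw
  exact (hf.unique hg 1).self_of_nhds

end JacobiExt

theorem mainTheorem5 :
    -- the single-valued function `F(1/2,1/2,1;z)` on `ℂ ∖ {1}` exists
    JacobiExt.IsSingleValuedHGF (1 / 2) (1 / 2) 1 (JacobiExt.hgf (1 / 2) (1 / 2) 1) ∧
    -- `λ` maps the upper half plane to `ℂ ∖ {0, 1}`
    (∀ τ : ℍ, JacobiExt.theta 0 0 τ ≠ 0 ∧ JacobiExt.lam τ ≠ 0 ∧ JacobiExt.lam τ ≠ 1) ∧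
    -- every point of the upper half plane has the form `g • τ₀`
    (∀ τ : ℍ, ∃ τ₀ ∈ JacobiExt.D2, ∃ g ∈ JacobiExt.Gamma24, τ = g • τ₀) ∧
    -- the extended formula
    ∀ (τ τ₀ : ℍ) (g : SL(2, ℤ)), τ₀ ∈ JacobiExt.D2 → g ∈ JacobiExt.Gamma24 → τ = g • τ₀ →
      (∀ γ : Path τ₀ τ,
        (∃! v : ℂ, JacobiExt.IsContinuationValue (1 / 2) (1 / 2) 1
          (fun t => JacobiExt.lam (γ t)) v) ∧
        JacobiExt.theta 0 0 τ ^ 2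
          = JacobiExt.hgfAlong (1 / 2) (1 / 2) 1 (fun t => JacobiExt.lam (γ t))) ∧
      JacobiExt.theta 0 0 τ ^ 2
        = ((g 1 0 : ℂ) * (τ₀ : ℂ) + (g 1 1 : ℂ))
          * JacobiExt.hgf (1 / 2) (1 / 2) 1 (JacobiExt.lam τ₀) ∧
      JacobiExt.theta 0 0 τ ^ 2
        = JacobiExt.hgf (1 / 2) (1 / 2) 1 (JacobiExt.lam τ)
          / (-(g 1 0 : ℂ) * (τ : ℂ) + (g 0 0 : ℂ)) := by
  refine ⟨JacobiExt.isSingleValuedHGF_hgf, fun τ => ?_, JacobiExt.exists_D2_smul_eq, ?_⟩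
  · rw [JacobiExt.lam_eq_lamC, JacobiExt.theta_zero_zero]
    exact ⟨JacobiExt.th00_ne_zero τ.im_pos, JacobiExt.lamC_ne_zero τ.im_pos,
      JacobiExt.lamC_ne_one τ.im_pos⟩
  · intro τ τ₀ g hτ₀ hg hτ
    obtain ⟨h1, h2⟩ := JacobiExt.Gamma24_le_thetaGroup hg τ₀
    have h3 := JacobiExt.autFactor_inv_smul g τ₀
    rw [← hτ] at h1 h2 h3
    refine ⟨fun γ => ?_, ?_, ?_⟩
    · have hv := JacobiExt.exists_isContinuationAlong hτ₀ γ
      -- Existence makes the chosen `hgfAlong` a genuine continuation value, and uniqueness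
      -- identifies it.
      exact ⟨⟨_, hv, fun w hw => hw.unique hv⟩, hv.unique (Classical.epsilon_spec ⟨_, hv⟩)⟩
    · rw [JacobiExt.theta_zero_zero, JacobiExt.lam_eq_lamC, JacobiExt.hgf_lamC hτ₀, h1,
        JacobiExt.autFactor]
    · rw [JacobiExt.theta_zero_zero, JacobiExt.lam_eq_lamC, h3, h2, JacobiExt.hgf_lamC hτ₀, h1,
        div_inv_eq_mul, mul_comm]
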